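/- Let $d\in\mathbb N$, $0<\beta<1$ and $x\ge 0$. Write $E_\beta(z)=\sum_{n\ge0} z^n/\Gamma(\beta n+1)$ for the Mittag-Leffler function, $M_\beta(z)=\sum_{n\ge 0}\frac{(-z)^n}{n!\,\Gamma(-\beta n+1-\beta)}$ for the $M$-Wright function (with $1/\Gamma=0$ at the poles of $\Gamma$), and $$\mathbb M^d_{\beta/2}(y,t)=2\int_0^\infty \frac{e^{-|y|^2/(4\tau)}}{(4\pi\tau)^{d/2}}\,t^{-\beta}M_\beta(\tau t^{-\beta})\,d\tau ,\qquad y\in\mathbb R^d,\ t>0.$$ Let $B^{\beta,1}$ be a $d$-dimensional generalized grey Brownian motion with $\alpha=1$, i.e. a process $(B^{\beta,1}(t))_{t\ge0}$ on a probability space with a.s. continuous paths, $B^{\beta,1}(0)=0$ a.s., and, for $0\le t_1<\dots<t_n$ and $\theta_1,\dots,\theta_n\in\mathbb R^d$, $$\mathbb E\Big(e^{i\sum_k(\theta_k,B^{\beta,1}(t_k))}\Big)=E_\beta\Big(-\tfrac12\sum_{j,k=1}^n\tfrac12\big(t_j+t_k-|t_j-t_k|\big)(\theta_j,\theta_k)\Big).$$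 Let $Z_x^\beta$ be the grey Ornstein-Uhlenbeck process, i.e. a process with a.s. continuous paths and $Z_x^\beta(0)=0$ solving $dZ_x^\beta(t)=-xZ_x^\beta(t)\,dt+dB^{\beta,1}(t)$, which means that a.s. $Z_x^\beta(t)=-x\int_0^tZ_x^\beta(s)\,ds+B^{\beta,1}(t)$ for all $t\ge0$. Then: 1. For all $t\ge0$ and $k\in\mathbb R^d$, $$\mathbb E\big(e^{i(k,Z_x^\beta(t))}\big)=E_\beta\Big(-\frac{|k|^2}{2}\,|f_x(t,\cdot)|^2\Big),\qquad f_x(t,s)=1_{[0,t)}(s)e^{-x(t-s)},$$ where $|\cdot|$ is the norm of $L^2(\mathbb R)$ when applied to $f_x(t,\cdot)$. 2. If $x>0$ and $t>0$, then $Z_x^\beta(t)$ has the density, with respect to Lebesgue measure on $\mathbb R^d$, $$\rho_x(y,t)=\frac12\,2^{d/2}\,\mathbb M^d_{\beta/2}\Big(\sqrt2\,y,\Big(\frac{1-e^{-2xt}}{2x}\Big)^{1/\beta}\Big);$$ for every $y\ne0$ the integral defining the right-hand side converges absolutely and $\rho_x(y,t)\ge0$. -/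

import Mathlib

open MeasureTheory

noncomputable section

/-- The Mittag-Leffler function `E_β(z) = ∑ zⁿ / Γ(β n + 1)`. -/
def mittagLeffler (β : ℝ) (z : ℂ) : ℂ :=
  ∑' n : ℕ, z ^ n / Complex.Gamma ((β : ℂ) * n + 1)

/-- The Wright function `W_{l,m}(z) = ∑ zⁿ / (n! Γ(l n + m))` at real arguments. At the poles of `Γ`
Mathlib sets `Γ = 0`, and division by zero gives `0`, so that `1 / Γ` is the usual entire
function. -/
def wrightFunction (l m z : ℝ) : ℝ :=
  ∑' n : ℕ, z ^ n / ((n.factorial : ℝ) * Real.Gamma (l * n + m))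

/-- The `M`-Wright function `M_β(z) = W_{-β, 1-β}(-z)` at real arguments. -/
def mWright (β z : ℝ) : ℝ :=
  wrightFunction (-β) (1 - β) (-z)

/-- The integrand of the `d`-dimensional `𝕄`-Wright function of order `β / 2`:
`τ ↦ (4πτ)^{-d/2} exp(-|y|²/(4τ)) t^{-β} M_β(τ t^{-β})`. -/
def mWrightIntegrand {d : ℕ} (β : ℝ) (y : EuclideanSpace ℝ (Fin d)) (t τ : ℝ) : ℝ :=
  Real.exp (-(‖y‖ ^ 2 / (4 * τ))) / (4 * Real.pi * τ) ^ ((d : ℝ) / 2) *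
    (t ^ (-β) * mWright β (τ * t ^ (-β)))

/-- The two-variable `𝕄`-Wright function `𝕄^d_{β/2}(y, t)` in space dimension `d`; its order
is `β / 2`, where `β` is the argument of this definition. -/
def mWrightHalf {d : ℕ} (β : ℝ) (y : EuclideanSpace ℝ (Fin d)) (t : ℝ) : ℝ :=
  2 * ∫ τ in Set.Ioi (0 : ℝ), mWrightIntegrand β y t τ

/-- `B = (B(t))_{t ≥ 0}` is a `d`-dimensional generalized grey Brownian motion with parameters
`β, α`: a stochastic process with almost surely continuous paths, starting at zero almost surely,
whose finite-dimensional distributions have the characteristic functions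
`E_β(-½ ∑_{j,k} ½ (t_j^α + t_k^α - |t_j - t_k|^α) (θ_j, θ_k))`.
Only times `t ≥ 0` matter. -/
structure IsGeneralizedGreyBM {Ω : Type*} [MeasurableSpace Ω] (P : Measure Ω) {d : ℕ}
    (β α : ℝ) (B : ℝ → Ω → EuclideanSpace ℝ (Fin d)) : Prop where
  measurable : ∀ t : ℝ, 0 ≤ t → Measurable (B t)
  continuous_paths : ∀ᵐ ω ∂P, ContinuousOn (fun t => B t ω) (Set.Ici 0)
  start_zero : ∀ᵐ ω ∂P, B 0 ω = 0
  char_fun : ∀ (n : ℕ) (t : Fin n → ℝ) (θ : Fin n → EuclideanSpace ℝ (Fin d)),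
    (∀ j, 0 ≤ t j) → StrictMono t →
    ∫ ω, Complex.exp (Complex.I * ((∑ j, inner ℝ (θ j) (B (t j) ω) : ℝ) : ℂ)) ∂P =
      mittagLeffler β ((-(1 / 2) * ∑ j, ∑ k,
        1 / 2 * ((t j) ^ α + (t k) ^ α - |t j - t k| ^ α) * inner ℝ (θ j) (θ k) : ℝ) : ℂ)

/-- `Z = (Z(t))_{t ≥ 0}` is a (continuous) solution, started at zero, of
`dZ(t) = -x Z(t) dt + dB(t)`: almost surely, `Z(t) = -x ∫₀ᵗ Z(s) ds + B(t)` for all `t ≥ 0`.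
The noise is additive, so no stochastic integral is needed. -/
structure IsOrnsteinUhlenbeckSolution {Ω : Type*} [MeasurableSpace Ω] (P : Measure Ω) {d : ℕ}
    (x : ℝ) (B Z : ℝ → Ω → EuclideanSpace ℝ (Fin d)) : Prop where
  measurable : ∀ t : ℝ, 0 ≤ t → Measurable (Z t)
  continuous_paths : ∀ᵐ ω ∂P, ContinuousOn (fun t => Z t ω) (Set.Ici 0)
  start_zero : ∀ᵐ ω ∂P, Z 0 ω = 0
  equation : ∀ᵐ ω ∂P, ∀ t : ℝ, 0 ≤ t → Z t ω = -(x • ∫ s in (0 : ℝ)..t, Z s ω) + B t ω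

/-- The kernel `f_x(t, s) = 1_{[0,t)}(s) e^{-x(t-s)}`. -/
def ouKernel (x t s : ℝ) : ℝ :=
  (Set.Ico 0 t).indicator (fun s => Real.exp (-x * (t - s))) s

end

/-!
The process `Z t` is an almost sure limit of weighted sums of increments of the grey Brownian motion
over uniform partitions of `[0, t]`, the weights being samples of `e^{-x(t - s)}`
(`tendsto_sum_exp_smul_sub`). The characteristic function of such a sum is the Mittag-Leffler
function `E_β` at `-|k|²/2` times a Riemann sum of `∫ ouKernel²`, because the covariance in the
definition of the process makes the increments uncorrelated
(`IsGeneralizedGreyBM.char_fun_increments`). The first claim follows by dominated convergence and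
the continuity of `E_β` on the negative half-line.

The second claim rests on three facts about the `M`-Wright function `M_β`: it is nonnegative
(`mWright_nonneg`), integrable (`integrableOn_mWright`), and `E_β(-s) = ∫₀^∞ e^{-sr} M_β(r) dr`
(`mittagLeffler_neg_eq_laplace`). Given these, `ρ` is a mixture of centered Gaussian densities with
mixing density `M_β`, by Fubini its Fourier transform is the characteristic function found before,
and a finite measure is determined by its characteristic function.

The three facts are obtained as follows.

* Termwise integration and the reflection formula express `M_β` through absolutely convergent
  integrals `∫₀^∞ ω u^{β-1} exp(-a u - r ω u^β) du`, where `ω` and `a` are unimodular with positive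
  real parts (`mWright_eq_rotatedIntegral`). Hence `M_β` is continuous and bounded on `[0, ∞)`, and
  its Mellin transform is `Γ(z) / Γ(1 - β(1 - z))` for `0 < Re z < 1` (`hasMellin_mWright`).
* Both sides of `∫₀^∞ e^{-t} t^{-β} M_β(r t^{-β}) dt = e^{-r}` then have the Mellin transform
  `Γ(z)`, so they agree (`integral_exp_mul_mWright`). By scaling, the Laplace transform of
  `t ↦ t^{-β} M_β(r t^{-β})` is `p ↦ p^{β-1} e^{-r p^β}`.
* That function is completely monotone, by the Lévy-Khintchine representation of `p^β`
  (`isLaplacePositive_rpow_mul_exp`), and a continuous function with a completely monotone Laplace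
  transform is nonnegative (`nonneg_of_isLaplacePositive`).
* Nonnegativity allows integrating the identity of the second item against `r^n`, which gives the
  moments `n! / Γ(βn + 1)` of `M_β` (`integral_pow_mul_mWright`), and with them the Laplace
  transform.
-/

/-! ### The Gamma integral with complex rate -/

lemma norm_cpow_mul_exp_neg {u : ℝ} (hu : 0 < u) (z a : ℂ) :
    ‖(u : ℂ) ^ (z - 1) * Complex.exp (-(a * u))‖ = u ^ (z.re - 1) * Real.exp (-(a.re * u)) := by
  rw [norm_mul, Complex.norm_cpow_eq_rpow_re_of_pos hu, Complex.norm_exp]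
  simp

lemma integrableOn_rpow_mul_exp_neg {s b : ℝ} (hs : 0 < s) (hb : 0 < b) :
    IntegrableOn (fun u : ℝ => u ^ (s - 1) * Real.exp (-(b * u))) (Set.Ioi 0) := by
  have := integrableOn_rpow_mul_exp_neg_mul_rpow (p := 1) (s := s - 1) (b := b)
    (by linarith) one_pos hb
  simpa using this

lemma aestronglyMeasurable_cpow_mul_exp_neg (z a : ℂ) :
    AEStronglyMeasurable (fun u : ℝ => (u : ℂ) ^ (z - 1) * Complex.exp (-(a * u)))
      (volume.restrict (Set.Ioi 0)) :=
  Measurable.aestronglyMeasurable (by fun_prop)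

lemma integrableOn_cpow_mul_exp_neg {z a : ℂ} (hz : 0 < z.re) (ha : 0 < a.re) :
    IntegrableOn (fun u : ℝ => (u : ℂ) ^ (z - 1) * Complex.exp (-(a * u))) (Set.Ioi 0) := by
  refine (integrableOn_rpow_mul_exp_neg hz ha).mono'
    (aestronglyMeasurable_cpow_mul_exp_neg z a) ?_
  filter_upwards [ae_restrict_mem measurableSet_Ioi] with u hu
  exact (norm_cpow_mul_exp_neg hu z a).le

/-- The integral `∫₀^∞ u^{z-1} e^{-au} du` is holomorphic in the rate `a`. -/
lemma differentiableAt_integral_cpow_mul_exp_neg {z a : ℂ} (hz : 0 < z.re) (ha : 0 < a.re) :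
    DifferentiableAt ℂ
      (fun a : ℂ => ∫ u : ℝ in Set.Ioi 0, (u : ℂ) ^ (z - 1) * Complex.exp (-(a * u))) a := by
  have hs : {w : ℂ | a.re / 2 < w.re} ∈ nhds a :=
    (isOpen_lt continuous_const Complex.continuous_re).mem_nhds (by simp; linarith)
  have hb : IntegrableOn
      (fun u : ℝ => u ^ ((z.re + 1) - 1) * Real.exp (-(a.re / 2 * u))) (Set.Ioi 0) :=
    integrableOn_rpow_mul_exp_neg (by linarith) (by linarith)
  refine (hasDerivAt_integral_of_dominated_loc_of_deriv_le
    (F' := fun (w : ℂ) (u : ℝ) => -((u : ℂ) ^ ((z + 1) - 1) * Complex.exp (-(w * u)))) hs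
    (Filter.Eventually.of_forall fun w => aestronglyMeasurable_cpow_mul_exp_neg z w)
    (integrableOn_cpow_mul_exp_neg hz ha)
    (aestronglyMeasurable_cpow_mul_exp_neg (z + 1) a).neg ?_ hb ?_).2.differentiableAt
  · filter_upwards [ae_restrict_mem measurableSet_Ioi] with u hu w hw
    rw [norm_neg, norm_cpow_mul_exp_neg hu]
    have hu' : (0 : ℝ) < u := hu
    have hw' : a.re / 2 < w.re := hw
    simp only [Complex.add_re, Complex.one_re]
    gcongr
  · filter_upwards [ae_restrict_mem measurableSet_Ioi] with u hu w _
    have hu' : (u : ℂ) ≠ 0 := Complex.ofReal_ne_zero.mpr (ne_of_gt hu)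
    have h1 : HasDerivAt (fun w : ℂ => Complex.exp (-(w * u)))
        (Complex.exp (-(w * u)) * -(1 * u)) w :=
      (((hasDerivAt_id w).mul_const (u : ℂ)).neg).cexp
    refine (h1.const_mul ((u : ℂ) ^ (z - 1))).congr_deriv ?_
    rw [show z + 1 - 1 = (z - 1) + 1 by ring, Complex.cpow_add _ _ hu', Complex.cpow_one]
    ring

/-- `∫₀^∞ u^{z-1} e^{-au} du = a^{-z} Γ(z)` for complex `a` with positive real part. Both sides are
holomorphic in `a`, and they agree for real `a`. -/
lemma integral_cpow_mul_exp_neg_mul {z a : ℂ} (hz : 0 < z.re) (ha : 0 < a.re) :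
    ∫ u : ℝ in Set.Ioi 0, (u : ℂ) ^ (z - 1) * Complex.exp (-(a * u)) =
      a ^ (-z) * Complex.Gamma z := by
  have hopen : IsOpen {w : ℂ | 0 < w.re} := isOpen_lt continuous_const Complex.continuous_re
  have hL : AnalyticOnNhd ℂ
      (fun a : ℂ => ∫ u : ℝ in Set.Ioi 0, (u : ℂ) ^ (z - 1) * Complex.exp (-(a * u)))
      {w : ℂ | 0 < w.re} :=
    DifferentiableOn.analyticOnNhd (fun w hw =>
      (differentiableAt_integral_cpow_mul_exp_neg hz hw).differentiableWithinAt) hopen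
  have hR : AnalyticOnNhd ℂ (fun a : ℂ => a ^ (-z) * Complex.Gamma z) {w : ℂ | 0 < w.re} := by
    refine DifferentiableOn.analyticOnNhd (fun w hw => ?_) hopen
    have hw' : w ∈ Complex.slitPlane := Or.inl hw
    exact ((differentiableAt_id.cpow_const hw').mul_const _).differentiableWithinAt
  have hpre : IsPreconnected {w : ℂ | 0 < w.re} :=
    (convex_halfSpace_re_gt 0).isPreconnected
  refine hL.eqOn_of_preconnected_of_frequently_eq hR hpre (z₀ := 1) (by simp) ?_ ha
  -- the two sides agree on the positive real axis, which accumulates at `1`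
  have hlim : Filter.Tendsto (fun r : ℝ => (r : ℂ)) (nhdsWithin 1 {1}ᶜ)
      (nhdsWithin (1 : ℂ) {1}ᶜ) := by
    refine tendsto_nhdsWithin_iff.mpr ⟨?_, ?_⟩
    · have := (Complex.continuous_ofReal.tendsto (1 : ℝ)).mono_left
        (nhdsWithin_le_nhds (s := {1}ᶜ))
      simpa using this
    · filter_upwards [self_mem_nhdsWithin] with r hr
      simpa using hr
  refine hlim.frequently (Filter.Eventually.frequently ?_)
  filter_upwards [nhdsWithin_le_nhds (lt_mem_nhds (zero_lt_one (α := ℝ)))] with r hr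
  rw [Complex.integral_cpow_mul_exp_neg_mul_Ioi hz hr, one_div, Complex.inv_cpow, Complex.cpow_neg]
  rw [Complex.arg_ofReal_of_nonneg hr.le]
  exact Real.pi_pos.ne

/-! ### Rotated integrals -/

/-- The integral `∫₀^∞ ω u^{β-1} exp(-a u - r ω u^β) du` with `ω = e^{iθ}` and `a = e^{-iη}`. For
`|θ|, |η| < π/2` it converges absolutely, and `M_β` is a combination of two such integrals. -/
noncomputable def rotatedIntegral (β θ η r : ℝ) : ℂ :=
  ∫ u : ℝ in Set.Ioi 0, Complex.exp (θ * Complex.I) * (u : ℂ) ^ ((β : ℂ) - 1) *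
    Complex.exp (-(Complex.exp (-(η * Complex.I)) * u)) *
    Complex.exp (-(r * Complex.exp (θ * Complex.I) * ((u ^ β : ℝ) : ℂ)))

lemma re_exp_mul_I (θ : ℝ) : (Complex.exp (θ * Complex.I)).re = Real.cos θ :=
  Complex.exp_ofReal_mul_I_re θ

lemma re_exp_neg_mul_I (η : ℝ) : (Complex.exp (-(η * Complex.I))).re = Real.cos η := by
  rw [← neg_mul, ← Complex.ofReal_neg, Complex.exp_ofReal_mul_I_re, Real.cos_neg]

lemma exp_mul_I_cpow {φ : ℝ} (h1 : -(Real.pi / 2) < φ) (h2 : φ < Real.pi / 2) (w : ℂ) :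
    Complex.exp (φ * Complex.I) ^ w = Complex.exp (φ * w * Complex.I) := by
  have hp := Real.pi_pos
  rw [Complex.cpow_def_of_ne_zero (Complex.exp_ne_zero _), Complex.log_exp]
  · ring_nf
  · simpa using by linarith
  · simpa using by linarith

lemma exp_neg_mul_I_cpow {φ : ℝ} (h1 : -(Real.pi / 2) < φ) (h2 : φ < Real.pi / 2) (w : ℂ) :
    Complex.exp (-(φ * Complex.I)) ^ w = Complex.exp (-(φ * w * Complex.I)) := by
  have := exp_mul_I_cpow (φ := -φ) (by linarith) (by linarith) w
  simpa using this

lemma ofReal_cpow_mul_rpow_pow {u : ℝ} (hu : 0 < u) (β : ℝ) (n : ℕ) :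
    (u : ℂ) ^ ((β : ℂ) - 1) * ((u ^ β : ℝ) : ℂ) ^ n = (u : ℂ) ^ ((β : ℂ) * (n + 1) - 1) := by
  have hu' : (u : ℂ) ≠ 0 := Complex.ofReal_ne_zero.mpr hu.ne'
  rw [Complex.ofReal_cpow hu.le, ← Complex.cpow_mul_nat, ← Complex.cpow_add _ _ hu']
  ring_nf

/-- A fractional power is dominated by any linear function, up to a constant. -/
lemma mul_rpow_le_mul_add {β : ℝ} (hβ0 : 0 < β) (hβ1 : β < 1) {r δ : ℝ} (hr : 0 ≤ r) (hδ : 0 < δ) :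
    ∃ K : ℝ, ∀ u : ℝ, 0 ≤ u → r * u ^ β ≤ δ * u + K := by
  -- weighted AM-GM for `δ u` and `K`, where `δ^β K^{1-β} = r`
  set K : ℝ := (r / δ ^ β) ^ (1 / (1 - β)) with hK
  have hK0 : 0 ≤ K := by positivity
  have hKp : K ^ (1 - β) = r / δ ^ β := by
    rw [hK, ← Real.rpow_mul (by positivity), one_div, inv_mul_cancel₀ (by linarith), Real.rpow_one]
  refine ⟨K, fun u hu => ?_⟩
  have h := Real.geom_mean_le_arith_mean2_weighted hβ0.le (by linarith : 0 ≤ 1 - β)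
    (mul_nonneg hδ.le hu) hK0 (by ring)
  rw [hKp, Real.mul_rpow hδ.le hu] at h
  have hδβ : 0 < δ ^ β := by positivity
  have h2 : δ ^ β * u ^ β * (r / δ ^ β) = r * u ^ β := by field_simp
  have h3 : β * (δ * u) ≤ 1 * (δ * u) := by
    have : 0 ≤ δ * u := by positivity
    gcongr
  nlinarith

lemma integrableOn_rpow_mul_exp_neg_mul_exp {β : ℝ} (hβ0 : 0 < β) (hβ1 : β < 1) {b r : ℝ}
    (hb : 0 < b) (hr : 0 ≤ r) :
    IntegrableOn (fun u : ℝ => u ^ (β - 1) * Real.exp (-(b * u)) * Real.exp (r * u ^ β))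
      (Set.Ioi 0) := by
  obtain ⟨K, hK⟩ := mul_rpow_le_mul_add hβ0 hβ1 hr (half_pos hb)
  refine ((integrableOn_rpow_mul_exp_neg hβ0 (half_pos hb)).const_mul (Real.exp K)).mono'
    (Measurable.aestronglyMeasurable (by fun_prop)) ?_
  filter_upwards [ae_restrict_mem measurableSet_Ioi] with u hu
  have hu' : (0 : ℝ) < u := hu
  rw [Real.norm_of_nonneg (by positivity), mul_assoc, ← Real.exp_add, mul_left_comm, ← Real.exp_add]
  refine mul_le_mul_of_nonneg_left (Real.exp_le_exp.mpr ?_) (by positivity)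
  have := hK u hu'.le
  linarith

/-- Termwise integration of the exponential series in `rotatedIntegral`. -/
lemma hasSum_rotatedIntegral {β : ℝ} (hβ0 : 0 < β) (hβ1 : β < 1) {θ η : ℝ}
    (hη1 : -(Real.pi / 2) < η) (hη2 : η < Real.pi / 2) {r : ℝ} (hr : 0 ≤ r) :
    HasSum (fun n : ℕ => (-(r : ℂ)) ^ n / (n.factorial : ℂ) *
      (Complex.exp ((θ + β * η) * (n + 1) * Complex.I) * Complex.Gamma (β * (n + 1))))
      (rotatedIntegral β θ η r) := by
  set ω : ℂ := Complex.exp (θ * Complex.I) with hω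
  set a : ℂ := Complex.exp (-(η * Complex.I)) with ha
  have hare : 0 < a.re := by
    rw [ha, re_exp_neg_mul_I]
    exact Real.cos_pos_of_mem_Ioo ⟨hη1, hη2⟩
  have hωn : ‖ω‖ = 1 := Complex.norm_exp_ofReal_mul_I θ
  have key := hasSum_integral_of_dominated_convergence (μ := volume.restrict (Set.Ioi (0 : ℝ)))
    (F := fun (n : ℕ) (u : ℝ) => ω * (u : ℂ) ^ ((β : ℂ) - 1) * Complex.exp (-(a * u)) *
      ((-(r * ω * ((u ^ β : ℝ) : ℂ))) ^ n / (n.factorial : ℂ)))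
    (f := fun u : ℝ => ω * (u : ℂ) ^ ((β : ℂ) - 1) * Complex.exp (-(a * u)) *
      Complex.exp (-(r * ω * ((u ^ β : ℝ) : ℂ))))
    (fun n u => u ^ (β - 1) * Real.exp (-(a.re * u)) * ((r * u ^ β) ^ n / n.factorial))
    ?_ ?_ ?_ ?_ ?_
  · refine (congrArg (HasSum · _) (funext fun n => ?_)).mpr key
    have hz : 0 < ((β : ℂ) * (n + 1)).re := by
      have : ((β : ℂ) * (n + 1)) = ((β * (n + 1) : ℝ) : ℂ) := by push_cast; ring
      rw [this, Complex.ofReal_re]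
      positivity
    have h1 := integral_cpow_mul_exp_neg_mul hz hare
    have h2 : a ^ (-((β : ℂ) * (n + 1))) = Complex.exp (β * η * (n + 1) * Complex.I) := by
      rw [ha, exp_neg_mul_I_cpow hη1 hη2]
      ring_nf
    have h3 : ω ^ (n + 1) = Complex.exp (θ * (n + 1) * Complex.I) := by
      rw [hω, ← Complex.exp_nat_mul]
      push_cast
      ring_nf
    rw [h2] at h1
    rw [show ((θ : ℂ) + β * η) * (n + 1) * Complex.I =
      θ * (n + 1) * Complex.I + β * η * (n + 1) * Complex.I by ring, Complex.exp_add, ← h3,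
      mul_assoc (ω ^ (n + 1)), ← h1, ← integral_const_mul, ← integral_const_mul]
    refine setIntegral_congr_fun measurableSet_Ioi fun u hu => ?_
    rw [← ofReal_cpow_mul_rpow_pow hu]
    ring
  · exact fun n => Measurable.aestronglyMeasurable (by fun_prop)
  · intro n
    filter_upwards [ae_restrict_mem measurableSet_Ioi] with u hu
    have hu' : (0 : ℝ) < u := hu
    rw [norm_mul, mul_assoc ω, norm_mul, norm_cpow_mul_exp_neg hu, hωn, norm_div, norm_pow,
      norm_neg, norm_mul, norm_mul, hωn, Complex.norm_real, Complex.norm_real,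
      Real.norm_of_nonneg hr, Real.norm_of_nonneg (by positivity), Complex.norm_natCast]
    simp
  · exact Filter.Eventually.of_forall fun u =>
      (Real.summable_pow_div_factorial (r * u ^ β)).mul_left _
  · refine (integrableOn_rpow_mul_exp_neg_mul_exp hβ0 hβ1 hare hr).congr
      (Filter.Eventually.of_forall fun u => ?_)
    simp only
    rw [tsum_mul_left, Real.exp_eq_exp_ℝ, NormedSpace.exp_eq_tsum_div]
  · refine Filter.Eventually.of_forall fun u => HasSum.mul_left _ ?_
    rw [Complex.exp_eq_exp_ℂ]
    exact NormedSpace.expSeries_div_hasSum_exp _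

lemma norm_rotatedIntegrand (β θ η r : ℝ) {u : ℝ} (hu : 0 < u) :
    ‖Complex.exp (θ * Complex.I) * (u : ℂ) ^ ((β : ℂ) - 1) *
      Complex.exp (-(Complex.exp (-(η * Complex.I)) * u)) *
      Complex.exp (-(r * Complex.exp (θ * Complex.I) * ((u ^ β : ℝ) : ℂ)))‖ =
    u ^ (β - 1) * Real.exp (-(Real.cos η * u)) * Real.exp (-(r * Real.cos θ * u ^ β)) := by
  have h : (r * Complex.exp (θ * Complex.I) * ((u ^ β : ℝ) : ℂ)).re = r * Real.cos θ * u ^ β := by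
    rw [Complex.re_mul_ofReal, Complex.re_ofReal_mul, re_exp_mul_I]
  rw [norm_mul, mul_assoc (Complex.exp (θ * Complex.I)), norm_mul, norm_cpow_mul_exp_neg hu,
    Complex.norm_exp_ofReal_mul_I, Complex.norm_exp, re_exp_neg_mul_I, Complex.neg_re, h, one_mul,
    Complex.ofReal_re]

lemma ofReal_mul_cpow {r : ℝ} (hr : 0 < r) {w : ℂ} (hw : w ≠ 0) (z : ℂ) :
    ((r : ℂ) * w) ^ z = (r : ℂ) ^ z * w ^ z := by
  have hr' : (r : ℂ) ≠ 0 := Complex.ofReal_ne_zero.mpr hr.ne'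
  rw [Complex.cpow_def_of_ne_zero (mul_ne_zero hr' hw), Complex.log_ofReal_mul hr hw,
    Complex.cpow_def_of_ne_zero hr', Complex.cpow_def_of_ne_zero hw, ← Complex.exp_add,
    Complex.ofReal_log hr.le]
  ring_nf

lemma ofReal_rpow_cpow {u : ℝ} (hu : 0 < u) (β : ℝ) (w : ℂ) :
    ((u ^ β : ℝ) : ℂ) ^ w = (u : ℂ) ^ ((β : ℂ) * w) := by
  have h1 : ((u ^ β : ℝ) : ℂ) ≠ 0 := Complex.ofReal_ne_zero.mpr (by positivity)
  have h2 : (u : ℂ) ≠ 0 := Complex.ofReal_ne_zero.mpr hu.ne'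
  rw [Complex.cpow_def_of_ne_zero h1, Complex.cpow_def_of_ne_zero h2, ← Complex.ofReal_log hu.le,
    ← Complex.ofReal_log (by positivity), Real.log_rpow hu]
  push_cast
  ring_nf

lemma aestronglyMeasurable_rotatedIntegrand (β θ η r : ℝ) :
    AEStronglyMeasurable (fun u : ℝ => Complex.exp (θ * Complex.I) * (u : ℂ) ^ ((β : ℂ) - 1) *
      Complex.exp (-(Complex.exp (-(η * Complex.I)) * u)) *
      Complex.exp (-(r * Complex.exp (θ * Complex.I) * ((u ^ β : ℝ) : ℂ))))
      (volume.restrict (Set.Ioi 0)) :=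
  Measurable.aestronglyMeasurable (by fun_prop)

lemma norm_rotatedIntegrand_le (β η : ℝ) {θ r u : ℝ} (hθ : 0 ≤ Real.cos θ) (hr : 0 ≤ r)
    (hu : 0 < u) :
    ‖Complex.exp (θ * Complex.I) * (u : ℂ) ^ ((β : ℂ) - 1) *
      Complex.exp (-(Complex.exp (-(η * Complex.I)) * u)) *
      Complex.exp (-(r * Complex.exp (θ * Complex.I) * ((u ^ β : ℝ) : ℂ)))‖ ≤
    u ^ (β - 1) * Real.exp (-(Real.cos η * u)) := by
  rw [norm_rotatedIntegrand β θ η r hu]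
  refine mul_le_of_le_one_right (by positivity) (Real.exp_le_one_iff.mpr ?_)
  have : 0 ≤ r * Real.cos θ * u ^ β := by positivity
  linarith

lemma continuousOn_rotatedIntegral {β θ η : ℝ} (hβ0 : 0 < β) (hθ : 0 ≤ Real.cos θ)
    (hη : 0 < Real.cos η) : ContinuousOn (rotatedIntegral β θ η) (Set.Ici 0) := by
  refine continuousOn_of_dominated
    (fun r _ => aestronglyMeasurable_rotatedIntegrand β θ η r) (fun r hr => ?_)
    (integrableOn_rpow_mul_exp_neg hβ0 hη) (Filter.Eventually.of_forall fun u => ?_)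
  · filter_upwards [ae_restrict_mem measurableSet_Ioi] with u hu
    exact norm_rotatedIntegrand_le β η hθ hr hu
  · exact Continuous.continuousOn (by fun_prop)

lemma exists_norm_rotatedIntegral_le {β θ η : ℝ} (hβ0 : 0 < β) (hθ : 0 ≤ Real.cos θ)
    (hη : 0 < Real.cos η) : ∃ C, ∀ r, 0 ≤ r → ‖rotatedIntegral β θ η r‖ ≤ C := by
  refine ⟨∫ u in Set.Ioi (0 : ℝ), u ^ (β - 1) * Real.exp (-(Real.cos η * u)), fun r hr => ?_⟩
  refine norm_integral_le_of_norm_le (integrableOn_rpow_mul_exp_neg hβ0 hη) ?_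
  filter_upwards [ae_restrict_mem measurableSet_Ioi] with u hu
  exact norm_rotatedIntegrand_le β η hθ hr hu

lemma integrable_mellin_rotatedIntegrand {β θ η : ℝ} (hβ0 : 0 < β) (hθ : 0 < Real.cos θ)
    (hη : 0 < Real.cos η) {z : ℂ} (hz0 : 0 < z.re) (hz1 : z.re < 1) :
    Integrable (fun p : ℝ × ℝ => (p.2 : ℂ) ^ (z - 1) *
      (Complex.exp (θ * Complex.I) * (p.1 : ℂ) ^ ((β : ℂ) - 1) *
      Complex.exp (-(Complex.exp (-(η * Complex.I)) * p.1)) *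
      Complex.exp (-(p.2 * Complex.exp (θ * Complex.I) * ((p.1 ^ β : ℝ) : ℂ)))))
      ((volume.restrict (Set.Ioi (0 : ℝ))).prod (volume.restrict (Set.Ioi (0 : ℝ)))) := by
  have hnorm : ∀ u : ℝ, 0 < u → ∀ r : ℝ, 0 < r → ‖(r : ℂ) ^ (z - 1) *
      (Complex.exp (θ * Complex.I) * (u : ℂ) ^ ((β : ℂ) - 1) *
      Complex.exp (-(Complex.exp (-(η * Complex.I)) * u)) *
      Complex.exp (-(r * Complex.exp (θ * Complex.I) * ((u ^ β : ℝ) : ℂ))))‖ =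
      u ^ (β - 1) * Real.exp (-(Real.cos η * u)) *
        (r ^ (z.re - 1) * Real.exp (-((Real.cos θ * u ^ β) * r))) := by
    intro u hu r hr
    rw [norm_mul, norm_rotatedIntegrand β θ η r hu, Complex.norm_cpow_eq_rpow_re_of_pos hr,
      Complex.sub_re, Complex.one_re]
    ring_nf
  refine (integrable_prod_iff (Measurable.aestronglyMeasurable (by fun_prop))).mpr ⟨?_, ?_⟩
  · filter_upwards [ae_restrict_mem measurableSet_Ioi] with u hu
    have hu' : (0 : ℝ) < u := hu
    refine ((integrableOn_rpow_mul_exp_neg hz0 (b := Real.cos θ * u ^ β)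
      (by positivity)).const_mul (u ^ (β - 1) * Real.exp (-(Real.cos η * u)))).mono'
      (Measurable.aestronglyMeasurable (by fun_prop)) ?_
    filter_upwards [ae_restrict_mem measurableSet_Ioi] with r hr
    exact (hnorm u hu r hr).le
  · have hint := (integrableOn_rpow_mul_exp_neg (s := β * (1 - z.re))
      (mul_pos hβ0 (by linarith)) hη).const_mul ((Real.cos θ) ^ (-z.re) * Real.Gamma z.re)
    refine hint.congr ?_
    filter_upwards [ae_restrict_mem measurableSet_Ioi] with u hu
    have hu' : (0 : ℝ) < u := hu
    rw [setIntegral_congr_fun measurableSet_Ioi (fun r hr => hnorm u hu r hr),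
      integral_const_mul, Real.integral_rpow_mul_exp_neg_mul_Ioi hz0 (by positivity)]
    rw [one_div, Real.inv_rpow (by positivity), ← Real.rpow_neg (by positivity),
      Real.mul_rpow hθ.le (by positivity), ← Real.rpow_mul hu'.le,
      show β * (1 - z.re) - 1 = (β - 1) + β * -z.re by ring, Real.rpow_add hu']
    ring

lemma mellinConvergent_rotatedIntegral {β θ η : ℝ} (hβ0 : 0 < β) (hθ : 0 < Real.cos θ)
    (hη : 0 < Real.cos η) {z : ℂ} (hz0 : 0 < z.re) (hz1 : z.re < 1) :
    MellinConvergent (rotatedIntegral β θ η) z := by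
  have h := (integrable_mellin_rotatedIntegrand hβ0 hθ hη hz0 hz1).integral_prod_right
  refine h.congr (Filter.Eventually.of_forall fun r => ?_)
  simp only [smul_eq_mul, rotatedIntegral]
  rw [← integral_const_mul]

/-- The Mellin transform of `rotatedIntegral`, by Fubini: each integration is a Gamma integral. -/
lemma mellin_rotatedIntegral {β θ η : ℝ} (hβ0 : 0 < β)
    (hθ1 : -(Real.pi / 2) < θ) (hθ2 : θ < Real.pi / 2)
    (hη1 : -(Real.pi / 2) < η) (hη2 : η < Real.pi / 2) {z : ℂ} (hz0 : 0 < z.re) (hz1 : z.re < 1) :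
    mellin (rotatedIntegral β θ η) z =
      Complex.Gamma z * (Complex.exp ((θ + β * η) * (1 - z) * Complex.I) *
        Complex.Gamma (β * (1 - z))) := by
  have hθ : 0 < Real.cos θ := Real.cos_pos_of_mem_Ioo ⟨hθ1, hθ2⟩
  have hη : 0 < Real.cos η := Real.cos_pos_of_mem_Ioo ⟨hη1, hη2⟩
  have hswap := integral_integral_swap
    (f := fun (u r : ℝ) => (r : ℂ) ^ (z - 1) *
      (Complex.exp (θ * Complex.I) * (u : ℂ) ^ ((β : ℂ) - 1) *
      Complex.exp (-(Complex.exp (-(η * Complex.I)) * u)) *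
      Complex.exp (-(r * Complex.exp (θ * Complex.I) * ((u ^ β : ℝ) : ℂ)))))
    (integrable_mellin_rotatedIntegrand hβ0 hθ hη hz0 hz1)
  have hz' : 0 < ((β : ℂ) * (1 - z)).re := by
    rw [Complex.re_ofReal_mul]
    exact mul_pos hβ0 (by simpa using hz1)
  have ha : 0 < (Complex.exp (-(η * Complex.I))).re := by rwa [re_exp_neg_mul_I]
  calc mellin (rotatedIntegral β θ η) z
      = ∫ r in Set.Ioi (0 : ℝ), ∫ u in Set.Ioi (0 : ℝ), (r : ℂ) ^ (z - 1) *
      (Complex.exp (θ * Complex.I) * (u : ℂ) ^ ((β : ℂ) - 1) *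
      Complex.exp (-(Complex.exp (-(η * Complex.I)) * u)) *
      Complex.exp (-(r * Complex.exp (θ * Complex.I) * ((u ^ β : ℝ) : ℂ)))) := by
        simp only [mellin, smul_eq_mul, rotatedIntegral, integral_const_mul]
    _ = ∫ u in Set.Ioi (0 : ℝ), (Complex.Gamma z * Complex.exp (θ * (1 - z) * Complex.I)) *
      ((u : ℂ) ^ ((β : ℂ) * (1 - z) - 1) *
        Complex.exp (-(Complex.exp (-(η * Complex.I)) * u))) := by
        rw [← hswap]
        refine setIntegral_congr_fun measurableSet_Ioi fun u hu => ?_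
        have hu' : (0 : ℝ) < u := hu
        have hb : 0 < (Complex.exp (θ * Complex.I) * ((u ^ β : ℝ) : ℂ)).re := by
          rw [Complex.re_mul_ofReal, re_exp_mul_I]
          positivity
        have h1 := integral_cpow_mul_exp_neg_mul hz0 hb
        have h2 : (Complex.exp (θ * Complex.I) * ((u ^ β : ℝ) : ℂ)) ^ (-z) =
            Complex.exp (-(θ * z * Complex.I)) * (u : ℂ) ^ (-(β * z)) := by
          rw [mul_comm, ofReal_mul_cpow (by positivity) (Complex.exp_ne_zero _),
            ofReal_rpow_cpow hu', exp_mul_I_cpow hθ1 hθ2, mul_comm]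
          congr 2 <;> ring
        rw [h2] at h1
        calc ∫ r in Set.Ioi (0 : ℝ), (r : ℂ) ^ (z - 1) *
            (Complex.exp (θ * Complex.I) * (u : ℂ) ^ ((β : ℂ) - 1) *
            Complex.exp (-(Complex.exp (-(η * Complex.I)) * u)) *
            Complex.exp (-(r * Complex.exp (θ * Complex.I) * ((u ^ β : ℝ) : ℂ))))
            = ∫ r in Set.Ioi (0 : ℝ), (Complex.exp (θ * Complex.I) * (u : ℂ) ^ ((β : ℂ) - 1) *
            Complex.exp (-(Complex.exp (-(η * Complex.I)) * u))) * ((r : ℂ) ^ (z - 1) *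
              Complex.exp (-(Complex.exp (θ * Complex.I) * ((u ^ β : ℝ) : ℂ) * r))) := by
              refine setIntegral_congr_fun measurableSet_Ioi fun r _ => ?_
              ring_nf
          _ = _ := by
              rw [integral_const_mul, h1,
                show (β : ℂ) * (1 - z) - 1 = ((β : ℂ) - 1) + -(β * z) by ring,
                Complex.cpow_add _ _ (Complex.ofReal_ne_zero.mpr hu'.ne'),
                show (θ : ℂ) * (1 - z) * Complex.I = θ * Complex.I + -(θ * z * Complex.I) by ring,
                Complex.exp_add]
              ring
    _ = _ := by
        rw [integral_const_mul, integral_cpow_mul_exp_neg_mul hz' ha,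
          exp_neg_mul_I_cpow hη1 hη2]
        have : Complex.exp ((θ + β * η) * (1 - z) * Complex.I) =
          Complex.exp (θ * (1 - z) * Complex.I) *
            Complex.exp (-(η * -(β * (1 - z)) * Complex.I)) := by
          rw [← Complex.exp_add]; ring_nf
        rw [this]
        ring

/-! ### The `M`-Wright function as a combination of rotated integrals -/

/-- The reflection formula for `1 / Γ`, valid also at the poles of `Γ (1 - z)`. -/
lemma inv_Gamma_one_sub {z : ℂ} (hz : 0 < z.re) :
    (Complex.Gamma (1 - z))⁻¹ = Complex.Gamma z * Complex.sin (Real.pi * z) / Real.pi := by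
  have h := Complex.Gamma_mul_Gamma_one_sub z
  have hG := Complex.Gamma_ne_zero_of_re_pos hz
  have hpi : (Real.pi : ℂ) ≠ 0 := Complex.ofReal_ne_zero.mpr Real.pi_ne_zero
  rcases eq_or_ne (Complex.sin (Real.pi * z)) 0 with hs | hs
  · rw [hs, div_zero] at h
    rw [(mul_eq_zero.mp h).resolve_left hG, hs]
    simp
  · have : Complex.Gamma (1 - z) = Real.pi / Complex.sin (Real.pi * z) / Complex.Gamma z := by
      rw [← h]; field_simp
    rw [this]
    field_simp

/-- `e^{iw} - e^{-iw} = 2i sin w`, in the form in which the two rotations combine. -/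
lemma exp_mul_I_sub_exp_neg (w : ℂ) :
    (Complex.exp (w * Complex.I) - Complex.exp (-w * Complex.I)) / (2 * Real.pi * Complex.I) =
      Complex.sin w / Real.pi := by
  have hpi : (Real.pi : ℂ) ≠ 0 := Complex.ofReal_ne_zero.mpr Real.pi_ne_zero
  rw [Complex.sin]
  field_simp
  rw [Complex.I_sq]
  ring

/-- The angle `θ` of `ω`. Together with the angle `η = πβ/2` it satisfies `θ + βη = πβ`, and both
angles lie in `(0, π/2)` for every `0 < β < 1`, so that the rotated integrals converge. -/
noncomputable def wrightAngle (β : ℝ) : ℝ := Real.pi * β * (2 - β) / 2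

lemma wrightAngle_pos {β : ℝ} (hβ0 : 0 < β) (hβ1 : β < 1) : 0 < wrightAngle β := by
  have := Real.pi_pos
  have : 0 < 2 - β := by linarith
  rw [wrightAngle]
  positivity

lemma wrightAngle_lt {β : ℝ} (hβ1 : β < 1) : wrightAngle β < Real.pi / 2 := by
  have := Real.pi_pos
  have h : 0 < Real.pi * (1 - β) ^ 2 := by
    have : 0 < 1 - β := by linarith
    positivity
  rw [wrightAngle]
  nlinarith

lemma pi_mul_div_two_lt {β : ℝ} (hβ1 : β < 1) : Real.pi * β / 2 < Real.pi / 2 := by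
  have := Real.pi_pos
  nlinarith

lemma wrightAngle_add (β : ℝ) :
    (wrightAngle β : ℂ) + β * ((Real.pi * β / 2 : ℝ) : ℂ) = Real.pi * β := by
  rw [wrightAngle]
  push_cast
  ring

lemma wrightAngle_neg_add (β : ℝ) :
    ((-wrightAngle β : ℝ) : ℂ) + β * ((-(Real.pi * β / 2) : ℝ) : ℂ) = -(Real.pi * β) := by
  rw [wrightAngle]
  push_cast
  ring

lemma cos_wrightAngle_pos {β : ℝ} (hβ0 : 0 < β) (hβ1 : β < 1) : 0 < Real.cos (wrightAngle β) :=
  Real.cos_pos_of_mem_Ioo ⟨by linarith [wrightAngle_pos hβ0 hβ1, Real.pi_pos], wrightAngle_lt hβ1⟩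

lemma cos_pi_mul_div_two_pos {β : ℝ} (hβ0 : 0 < β) (hβ1 : β < 1) :
    0 < Real.cos (Real.pi * β / 2) :=
  Real.cos_pos_of_mem_Ioo ⟨by
    have := Real.pi_pos
    have : 0 < Real.pi * β / 2 := by positivity
    linarith, pi_mul_div_two_lt hβ1⟩

/-- The series of `M_β` converges to `(J - J') / (2πi)`, where `J` and `J'` are rotated integrals
with opposite angles: the reflection formula turns `Γ(β(n+1)) sin(πβ(n+1)) / π` into
`1 / Γ(1 - β(n+1))`. -/
lemma mWright_eq_rotatedIntegral {β : ℝ} (hβ0 : 0 < β) (hβ1 : β < 1) {r : ℝ} (hr : 0 ≤ r) :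
    ((mWright β r : ℝ) : ℂ) =
      (rotatedIntegral β (wrightAngle β) (Real.pi * β / 2) r -
        rotatedIntegral β (-wrightAngle β) (-(Real.pi * β / 2)) r) /
        (2 * Real.pi * Complex.I) := by
  have hp := Real.pi_pos
  have hη : 0 < Real.pi * β / 2 := by positivity
  have hη' := pi_mul_div_two_lt hβ1
  have h1 := hasSum_rotatedIntegral hβ0 hβ1 (θ := wrightAngle β) (η := Real.pi * β / 2)
    (by linarith) hη' hr
  have h2 := hasSum_rotatedIntegral hβ0 hβ1 (θ := -wrightAngle β) (η := -(Real.pi * β / 2))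
    (by linarith) (by linarith) hr
  rw [wrightAngle_add] at h1
  rw [wrightAngle_neg_add] at h2
  rw [← ((h1.sub h2).div_const (2 * Real.pi * Complex.I)).tsum_eq, mWright, wrightFunction,
    Complex.ofReal_tsum]
  refine tsum_congr fun n => ?_
  have hz : 0 < ((β : ℂ) * (n + 1)).re := by
    have : ((β : ℂ) * (n + 1)) = ((β * (n + 1) : ℝ) : ℂ) := by push_cast; ring
    rw [this, Complex.ofReal_re]
    positivity
  have hG : ((Real.Gamma (-β * n + (1 - β)) : ℝ) : ℂ) = Complex.Gamma (1 - β * (n + 1)) := by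
    rw [← Complex.Gamma_ofReal]
    push_cast
    ring_nf
  rw [← mul_sub, ← sub_mul, mul_div_assoc, mul_div_right_comm,
    show -((Real.pi : ℂ) * β) * (n + 1) * Complex.I =
      -(Real.pi * (β * (n + 1))) * Complex.I by ring,
    show ((Real.pi : ℂ) * β) * (n + 1) * Complex.I =
      (Real.pi * (β * (n + 1))) * Complex.I by ring, exp_mul_I_sub_exp_neg]
  push_cast
  rw [hG, div_mul_eq_div_div, div_eq_mul_inv _ (Complex.Gamma _), inv_Gamma_one_sub hz]
  ring

lemma continuousOn_ofReal_mWright {β : ℝ} (hβ0 : 0 < β) (hβ1 : β < 1) :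
    ContinuousOn (fun r => ((mWright β r : ℝ) : ℂ)) (Set.Ici 0) := by
  have h1 := continuousOn_rotatedIntegral (θ := wrightAngle β) (η := Real.pi * β / 2) hβ0
    (cos_wrightAngle_pos hβ0 hβ1).le (cos_pi_mul_div_two_pos hβ0 hβ1)
  have h2 := continuousOn_rotatedIntegral (θ := -wrightAngle β) (η := -(Real.pi * β / 2)) hβ0
    (by rw [Real.cos_neg]; exact (cos_wrightAngle_pos hβ0 hβ1).le)
    (by rw [Real.cos_neg]; exact cos_pi_mul_div_two_pos hβ0 hβ1)
  exact ((h1.sub h2).div_const (2 * Real.pi * Complex.I)).congr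
    fun r hr => mWright_eq_rotatedIntegral hβ0 hβ1 hr

lemma continuousOn_mWright {β : ℝ} (hβ0 : 0 < β) (hβ1 : β < 1) :
    ContinuousOn (mWright β) (Set.Ici 0) :=
  Complex.continuous_re.comp_continuousOn (continuousOn_ofReal_mWright hβ0 hβ1)

lemma exists_abs_mWright_le {β : ℝ} (hβ0 : 0 < β) (hβ1 : β < 1) :
    ∃ C, ∀ r, 0 ≤ r → |mWright β r| ≤ C := by
  obtain ⟨C₁, h1⟩ := exists_norm_rotatedIntegral_le (θ := wrightAngle β) (η := Real.pi * β / 2) hβ0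
    (cos_wrightAngle_pos hβ0 hβ1).le (cos_pi_mul_div_two_pos hβ0 hβ1)
  obtain ⟨C₂, h2⟩ := exists_norm_rotatedIntegral_le (θ := -wrightAngle β)
    (η := -(Real.pi * β / 2)) hβ0
    (by rw [Real.cos_neg]; exact (cos_wrightAngle_pos hβ0 hβ1).le)
    (by rw [Real.cos_neg]; exact cos_pi_mul_div_two_pos hβ0 hβ1)
  refine ⟨(C₁ + C₂) / ‖2 * Real.pi * Complex.I‖, fun r hr => ?_⟩
  rw [← Real.norm_eq_abs, ← Complex.norm_real, mWright_eq_rotatedIntegral hβ0 hβ1 hr, norm_div]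
  gcongr
  exact (norm_sub_le _ _).trans (add_le_add (h1 r hr) (h2 r hr))

/-- The Mellin transform of `M_β` on the strip `0 < Re z < 1`. -/
lemma hasMellin_mWright {β : ℝ} (hβ0 : 0 < β) (hβ1 : β < 1) {z : ℂ} (hz0 : 0 < z.re)
    (hz1 : z.re < 1) :
    HasMellin (fun r => ((mWright β r : ℝ) : ℂ)) z
      (Complex.Gamma z / Complex.Gamma (1 - β * (1 - z))) := by
  have hp := Real.pi_pos
  have hη : 0 < Real.pi * β / 2 := by positivity
  have hη' := pi_mul_div_two_lt hβ1
  have hθ := wrightAngle_pos hβ0 hβ1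
  have hθ' := wrightAngle_lt hβ1
  have c1 := mellinConvergent_rotatedIntegral hβ0 (cos_wrightAngle_pos hβ0 hβ1)
    (cos_pi_mul_div_two_pos hβ0 hβ1) hz0 hz1
  have c2 := mellinConvergent_rotatedIntegral (θ := -wrightAngle β) (η := -(Real.pi * β / 2)) hβ0
    (by rw [Real.cos_neg]; exact cos_wrightAngle_pos hβ0 hβ1)
    (by rw [Real.cos_neg]; exact cos_pi_mul_div_two_pos hβ0 hβ1) hz0 hz1
  have m1 := mellin_rotatedIntegral (θ := wrightAngle β) (η := Real.pi * β / 2) hβ0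
    (by linarith) hθ' (by linarith) hη' hz0 hz1
  have m2 := mellin_rotatedIntegral (θ := -wrightAngle β) (η := -(Real.pi * β / 2)) hβ0
    (by linarith) (by linarith) (by linarith) (by linarith) hz0 hz1
  rw [wrightAngle_add] at m1
  rw [wrightAngle_neg_add] at m2
  have hs := hasMellin_sub c1 c2
  have hw : 0 < ((β : ℂ) * (1 - z)).re := by
    rw [Complex.re_ofReal_mul]
    exact mul_pos hβ0 (by simpa using hz1)
  constructor
  · refine (hs.1.div_const (2 * Real.pi * Complex.I)).congr_fun (fun r hr => ?_) measurableSet_Ioi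
    simp only
    rw [mWright_eq_rotatedIntegral hβ0 hβ1 (le_of_lt hr)]
  · have e : mellin (fun r => ((mWright β r : ℝ) : ℂ)) z =
        mellin (fun r => (rotatedIntegral β (wrightAngle β) (Real.pi * β / 2) r -
          rotatedIntegral β (-wrightAngle β) (-(Real.pi * β / 2)) r) /
          (2 * Real.pi * Complex.I)) z := by
      refine setIntegral_congr_fun measurableSet_Ioi fun r hr => ?_
      simp only
      rw [mWright_eq_rotatedIntegral hβ0 hβ1 (le_of_lt hr)]
    rw [e, mellin_div_const, hs.2, m1, m2, ← mul_sub, ← sub_mul, mul_div_assoc, mul_div_right_comm,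
      show -((Real.pi : ℂ) * β) * (1 - z) * Complex.I =
        -(Real.pi * (β * (1 - z))) * Complex.I by ring,
      show ((Real.pi : ℂ) * β) * (1 - z) * Complex.I =
        (Real.pi * (β * (1 - z))) * Complex.I by ring, exp_mul_I_sub_exp_neg,
      div_eq_mul_inv _ (Complex.Gamma (1 - _)), inv_Gamma_one_sub hw]
    ring

/-! ### The Laplace transform of `t ↦ t^{-β} M_β(r t^{-β})` -/

lemma continuousAt_mWright {β : ℝ} (hβ0 : 0 < β) (hβ1 : β < 1) {r : ℝ} (hr : 0 < r) :
    ContinuousAt (mWright β) r :=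
  (continuousOn_mWright hβ0 hβ1).continuousAt (Ici_mem_nhds hr)

lemma continuousOn_rpow_mul_mWright {β : ℝ} (hβ0 : 0 < β) (hβ1 : β < 1) :
    ContinuousOn (fun p : ℝ × ℝ => p.1 ^ (-β) * mWright β (p.1 ^ (-β) * p.2))
      (Set.Ioi 0 ×ˢ Set.Ioi 0) := by
  have h1 : ContinuousOn (fun p : ℝ × ℝ => p.1 ^ (-β)) (Set.Ioi 0 ×ˢ Set.Ioi 0) :=
    continuousOn_fst.rpow_const fun p hp => Or.inl (ne_of_gt hp.1)
  refine h1.mul ((continuousOn_mWright hβ0 hβ1).comp (h1.mul continuousOn_snd) fun p hp => ?_)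
  have hp1 : 0 < p.1 := hp.1
  have hp2 : 0 < p.2 := hp.2
  simp only [Set.mem_Ici]
  positivity

lemma integrable_mellin_subordination {β : ℝ} (hβ0 : 0 < β) (hβ1 : β < 1) {z : ℂ}
    (hz0 : 0 < z.re) (hz1 : z.re < 1) :
    Integrable (fun p : ℝ × ℝ => (p.2 : ℂ) ^ (z - 1) * (Real.exp (-p.1) : ℂ) *
      ((p.1 ^ (-β) * mWright β (p.1 ^ (-β) * p.2) : ℝ) : ℂ))
      ((volume.restrict (Set.Ioi (0 : ℝ))).prod (volume.restrict (Set.Ioi (0 : ℝ)))) := by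
  have hmeas : AEStronglyMeasurable (fun p : ℝ × ℝ =>
      ((p.1 ^ (-β) * mWright β (p.1 ^ (-β) * p.2) : ℝ) : ℂ))
      ((volume.restrict (Set.Ioi (0 : ℝ))).prod (volume.restrict (Set.Ioi (0 : ℝ)))) := by
    rw [Measure.prod_restrict]
    exact (Complex.continuous_ofReal.comp_continuousOn
      (continuousOn_rpow_mul_mWright hβ0 hβ1)).aestronglyMeasurable
      (measurableSet_Ioi.prod measurableSet_Ioi)
  have hM := (hasMellin_mWright hβ0 hβ1 hz0 hz1).1
  have hmeas' : AEStronglyMeasurable (fun p : ℝ × ℝ => (p.2 : ℂ) ^ (z - 1) *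
      (Real.exp (-p.1) : ℂ) * ((p.1 ^ (-β) * mWright β (p.1 ^ (-β) * p.2) : ℝ) : ℂ))
      ((volume.restrict (Set.Ioi (0 : ℝ))).prod (volume.restrict (Set.Ioi (0 : ℝ)))) :=
    AEStronglyMeasurable.mul (Measurable.aestronglyMeasurable (by fun_prop)) hmeas
  refine (integrable_prod_iff hmeas').mpr ⟨?_, ?_⟩
  · filter_upwards [ae_restrict_mem measurableSet_Ioi] with t ht
    have ht' : (0 : ℝ) < t ^ (-β) := Real.rpow_pos_of_pos ht _
    have h := (((MellinConvergent.comp_mul_left ht').mpr hM).const_mul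
      ((Real.exp (-t) : ℂ) * ((t ^ (-β) : ℝ) : ℂ)))
    refine h.congr (Filter.Eventually.of_forall fun r => ?_)
    simp only [smul_eq_mul]
    push_cast
    ring
  · have hint := (integrableOn_rpow_mul_exp_neg (s := 1 - β * (1 - z.re)) (b := 1)
      (by nlinarith) one_pos).mul_const
        (∫ r in Set.Ioi (0 : ℝ), r ^ (z.re - 1) * |mWright β r|)
    refine hint.congr ?_
    filter_upwards [ae_restrict_mem measurableSet_Ioi] with t ht
    have ht0 : (0 : ℝ) < t := ht
    set a : ℝ := t ^ (-β) with ha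
    have ha0 : (0 : ℝ) < a := Real.rpow_pos_of_pos ht _
    have e1 : ∀ r ∈ Set.Ioi (0 : ℝ), ‖(r : ℂ) ^ (z - 1) * (Real.exp (-t) : ℂ) *
        ((a * mWright β (a * r) : ℝ) : ℂ)‖ = Real.exp (-t) * a * a ^ (1 - z.re) *
          ((a * r) ^ (z.re - 1) * |mWright β (a * r)|) := by
      intro r hr
      have hr0 : (0 : ℝ) < r := hr
      rw [norm_mul, norm_mul, Complex.norm_cpow_eq_rpow_re_of_pos hr, Complex.norm_real,
        Complex.norm_real, Real.norm_of_nonneg (Real.exp_pos _).le, Real.norm_eq_abs, abs_mul,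
        abs_of_pos ha0, Real.mul_rpow ha0.le hr0.le, show 1 - z.re = -(z.re - 1) by ring,
        Real.rpow_neg ha0.le]
      have : a ^ (z.re - 1) ≠ 0 := (Real.rpow_pos_of_pos ha0 _).ne'
      simp only [Complex.sub_re, Complex.one_re]
      field_simp
    rw [setIntegral_congr_fun measurableSet_Ioi e1, integral_const_mul,
      integral_comp_mul_left_Ioi (fun x => x ^ (z.re - 1) * |mWright β x|) 0 ha0, mul_zero,
      smul_eq_mul]
    have e2 : t ^ (1 - β * (1 - z.re) - 1) = a ^ (1 - z.re) := by
      rw [ha, ← Real.rpow_mul ht0.le]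
      ring_nf
    rw [e2, one_mul]
    field_simp

lemma continuousAt_integral_subordination {β : ℝ} (hβ0 : 0 < β) (hβ1 : β < 1) {r : ℝ}
    (hr : 0 < r) :
    ContinuousAt (fun r : ℝ => ∫ t in Set.Ioi (0 : ℝ), (Real.exp (-t) : ℂ) *
      ((t ^ (-β) * mWright β (t ^ (-β) * r) : ℝ) : ℂ)) r := by
  obtain ⟨C, hC⟩ := exists_abs_mWright_le hβ0 hβ1
  have hpos : ∀ᶠ s in nhds r, 0 < s := lt_mem_nhds hr
  refine continuousAt_of_dominated
    (bound := fun t => t ^ ((1 - β) - 1) * Real.exp (-(1 * t)) * C) ?_ ?_ ?_ ?_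
  · filter_upwards [hpos] with s hs
    have hc : ContinuousOn (fun t : ℝ => t ^ (-β) * mWright β (t ^ (-β) * s)) (Set.Ioi 0) :=
      (continuousOn_rpow_mul_mWright hβ0 hβ1).comp (f := fun t : ℝ => (t, s))
        (by fun_prop) fun t ht => ⟨ht, hs⟩
    exact AEStronglyMeasurable.mul (Measurable.aestronglyMeasurable (by fun_prop))
      ((Complex.continuous_ofReal.comp_continuousOn hc).aestronglyMeasurable measurableSet_Ioi)
  · filter_upwards [hpos] with s hs
    filter_upwards [ae_restrict_mem measurableSet_Ioi] with t ht
    have ht' : (0 : ℝ) < t ^ (-β) := Real.rpow_pos_of_pos ht _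
    rw [norm_mul, Complex.norm_real, Complex.norm_real, Real.norm_of_nonneg (Real.exp_pos _).le,
      Real.norm_eq_abs, abs_mul, abs_of_pos ht', show (1 - β) - 1 = -β by ring, one_mul,
      mul_comm (t ^ (-β)) (Real.exp _), ← mul_assoc]
    gcongr
    exact hC _ (by positivity)
  · exact (integrableOn_rpow_mul_exp_neg (by linarith) one_pos).mul_const C
  · filter_upwards [ae_restrict_mem measurableSet_Ioi] with t ht
    have ht' : (0 : ℝ) < t ^ (-β) := Real.rpow_pos_of_pos ht _
    refine continuousAt_const.mul (Complex.continuous_ofReal.continuousAt.comp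
      (continuousAt_const.mul ?_))
    exact ContinuousAt.comp (f := fun s => t ^ (-β) * s)
      (continuousAt_mWright hβ0 hβ1 (mul_pos ht' hr)) (by fun_prop)

/-- Both sides of `integral_exp_mul_mWright` have the Mellin transform `Γ(z)` on `0 < Re z < 1`. -/
lemma hasMellin_subordination {β : ℝ} (hβ0 : 0 < β) (hβ1 : β < 1) {z : ℂ}
    (hz0 : 0 < z.re) (hz1 : z.re < 1) :
    HasMellin (fun r : ℝ => ∫ t in Set.Ioi (0 : ℝ), (Real.exp (-t) : ℂ) *
      ((t ^ (-β) * mWright β (t ^ (-β) * r) : ℝ) : ℂ)) z (Complex.Gamma z) := by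
  have hint := integrable_mellin_subordination hβ0 hβ1 hz0 hz1
  have hM := (hasMellin_mWright hβ0 hβ1 hz0 hz1).2
  have hw : 0 < (1 - (β : ℂ) * (1 - z)).re := by
    rw [Complex.sub_re, Complex.re_ofReal_mul]
    simp only [Complex.one_re, Complex.sub_re]
    nlinarith
  constructor
  · refine hint.integral_prod_right.congr (Filter.Eventually.of_forall fun r => ?_)
    simp only [smul_eq_mul]
    rw [← integral_const_mul]
    simp only [mul_assoc]
  · calc mellin (fun r : ℝ => ∫ t in Set.Ioi (0 : ℝ), (Real.exp (-t) : ℂ) *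
          ((t ^ (-β) * mWright β (t ^ (-β) * r) : ℝ) : ℂ)) z
        = ∫ r in Set.Ioi (0 : ℝ), ∫ t in Set.Ioi (0 : ℝ), (r : ℂ) ^ (z - 1) *
          (Real.exp (-t) : ℂ) * ((t ^ (-β) * mWright β (t ^ (-β) * r) : ℝ) : ℂ) := by
          simp only [mellin, smul_eq_mul, mul_assoc, integral_const_mul]
      _ = ∫ t in Set.Ioi (0 : ℝ), ∫ r in Set.Ioi (0 : ℝ), (r : ℂ) ^ (z - 1) *
          (Real.exp (-t) : ℂ) * ((t ^ (-β) * mWright β (t ^ (-β) * r) : ℝ) : ℂ) :=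
          (integral_integral_swap (f := fun (t r : ℝ) => (r : ℂ) ^ (z - 1) *
          (Real.exp (-t) : ℂ) * ((t ^ (-β) * mWright β (t ^ (-β) * r) : ℝ) : ℂ)) hint).symm
      _ = ∫ t in Set.Ioi (0 : ℝ), (Complex.Gamma z / Complex.Gamma (1 - β * (1 - z))) *
          ((t : ℂ) ^ ((1 - (β : ℂ) * (1 - z)) - 1) * Complex.exp (-((1 : ℂ) * t))) := by
          refine setIntegral_congr_fun measurableSet_Ioi fun t ht => ?_
          have ht0 : (0 : ℝ) < t := ht
          have ha0 : (0 : ℝ) < t ^ (-β) := Real.rpow_pos_of_pos ht _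
          have e := mellin_comp_mul_left (fun r => ((mWright β r : ℝ) : ℂ)) z ha0
          rw [hM] at e
          calc ∫ r in Set.Ioi (0 : ℝ), (r : ℂ) ^ (z - 1) *
              (Real.exp (-t) : ℂ) * ((t ^ (-β) * mWright β (t ^ (-β) * r) : ℝ) : ℂ)
              = ((Real.exp (-t) : ℂ) * ((t ^ (-β) : ℝ) : ℂ)) *
                mellin (fun r => ((mWright β (t ^ (-β) * r) : ℝ) : ℂ)) z := by
                rw [mellin, ← integral_const_mul]
                refine setIntegral_congr_fun measurableSet_Ioi fun r _ => ?_
                simp only [smul_eq_mul]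
                push_cast
                ring
            _ = _ := by
                rw [e, smul_eq_mul, ofReal_rpow_cpow ht0,
                  show (1 - (β : ℂ) * (1 - z)) - 1 = ((-β : ℝ) : ℂ) + ((-β : ℝ) : ℂ) * -z by
                    push_cast; ring,
                  Complex.cpow_add _ _ (Complex.ofReal_ne_zero.mpr ht0.ne'),
                  Complex.ofReal_cpow ht0.le]
                push_cast
                ring_nf
      _ = Complex.Gamma z := by
          rw [integral_const_mul, integral_cpow_mul_exp_neg_mul hw (by simp), Complex.one_cpow,
            one_mul, div_mul_cancel₀ _ (Complex.Gamma_ne_zero_of_re_pos hw)]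

lemma hasMellin_exp_neg {z : ℂ} (hz : 0 < z.re) :
    HasMellin (fun r : ℝ => Complex.exp (-((1 : ℂ) * r))) z (Complex.Gamma z) := by
  refine ⟨integrableOn_cpow_mul_exp_neg hz (by simp), ?_⟩
  have := integral_cpow_mul_exp_neg_mul hz (a := 1) (by simp)
  rwa [Complex.one_cpow, one_mul] at this

/-- `∫₀^∞ e^{-t} t^{-β} M_β(r t^{-β}) dt = e^{-r}`, by uniqueness of the Mellin transform. -/
lemma integral_exp_mul_mWright {β : ℝ} (hβ0 : 0 < β) (hβ1 : β < 1) {r : ℝ} (hr : 0 < r) :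
    ∫ t in Set.Ioi (0 : ℝ), Real.exp (-t) * (t ^ (-β) * mWright β (t ^ (-β) * r)) =
      Real.exp (-r) := by
  set F : ℝ → ℂ := fun r => ∫ t in Set.Ioi (0 : ℝ), (Real.exp (-t) : ℂ) *
      ((t ^ (-β) * mWright β (t ^ (-β) * r) : ℝ) : ℂ) with hF
  set f : ℝ → ℂ := fun r => F r - Complex.exp (-((1 : ℂ) * r)) with hf
  have hmel : ∀ z : ℂ, 0 < z.re → z.re < 1 → HasMellin f z 0 := fun z h0 h1 => by
    have := hasMellin_sub (hasMellin_subordination hβ0 hβ1 h0 h1).1 (hasMellin_exp_neg h0).1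
    rw [(hasMellin_subordination hβ0 hβ1 h0 h1).2, (hasMellin_exp_neg h0).2, sub_self] at this
    exact this
  have hline : ∀ y : ℝ, mellin f (((1 / 2 : ℝ) : ℂ) + y * Complex.I) = 0 := fun y =>
    (hmel _ (by simp) (by simp; norm_num)).2
  have hinv := mellinInv_mellin_eq (1 / 2) f hr (hmel _ (by simp) (by simp; norm_num)).1
    (by simp only [Complex.VerticalIntegrable, hline]; exact integrable_zero _ _ _)
    ((continuousAt_integral_subordination hβ0 hβ1 hr).sub (by fun_prop))
  have h0 : f r = 0 := by
    rw [← hinv, mellinInv]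
    simp only [hline]
    simp
  have h1 : F r = Complex.exp (-((1 : ℂ) * r)) := sub_eq_zero.mp h0
  simp only [hF, ← Complex.ofReal_mul] at h1
  rw [integral_complex_ofReal] at h1
  apply Complex.ofReal_injective
  rw [h1]
  simp

/-- The Laplace transform `∫₀^∞ e^{-pt} t^{-β} M_β(r t^{-β}) dt = p^{β-1} e^{-r p^β}`. -/
lemma laplace_mWright {β : ℝ} (hβ0 : 0 < β) (hβ1 : β < 1) {r p : ℝ} (hr : 0 < r) (hp : 0 < p) :
    ∫ t in Set.Ioi (0 : ℝ), Real.exp (-(p * t)) * (t ^ (-β) * mWright β (t ^ (-β) * r)) =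
      p ^ (β - 1) * Real.exp (-(r * p ^ β)) := by
  have hpβ : 0 < p ^ β := by positivity
  rw [← integral_exp_mul_mWright hβ0 hβ1 (mul_pos hr hpβ)]
  have h := integral_comp_mul_left_Ioi (fun t : ℝ =>
    Real.exp (-t) * (t ^ (-β) * mWright β (t ^ (-β) * (r * p ^ β)))) 0 hp
  rw [mul_zero, smul_eq_mul] at h
  rw [show ∫ t in Set.Ioi (0 : ℝ), Real.exp (-t) * (t ^ (-β) * mWright β (t ^ (-β) * (r * p ^ β)))
    = p * (p⁻¹ * ∫ t in Set.Ioi (0 : ℝ), Real.exp (-t) *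
      (t ^ (-β) * mWright β (t ^ (-β) * (r * p ^ β)))) by rw [mul_inv_cancel_left₀ hp.ne'],
    ← h, ← integral_const_mul,
    ← integral_const_mul]
  refine setIntegral_congr_fun measurableSet_Ioi fun t ht => ?_
  have ht0 : (0 : ℝ) < t := ht
  rw [Real.mul_rpow hp.le ht0.le, Real.rpow_sub_one hp.ne', Real.rpow_neg hp.le,
    show (p ^ β)⁻¹ * t ^ (-β) * (r * p ^ β) = t ^ (-β) * r by field_simp]
  field_simp

/-! ### Completely monotone functions -/

/-- A form of complete monotonicity. If `f(p) = ∫ e^{-pt} dμ(t)` for a measure `μ` on `[0, ∞)`, then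
`∑ c_k f(k + 1) = ∫ e^{-t} q(e^{-t}) dμ(t) ≥ 0` for every polynomial `q = ∑ c_k X^k` that is
nonnegative on `[0, 1]`. The definition asks for these inequalities only. -/
def IsLaplacePositive (f : ℝ → ℝ) : Prop :=
  ∀ (N : ℕ) (c : ℕ → ℝ), (∀ x ∈ Set.Icc (0 : ℝ) 1, 0 ≤ ∑ k ∈ Finset.range N, c k * x ^ k) →
    0 ≤ ∑ k ∈ Finset.range N, c k * f (k + 1)

namespace IsLaplacePositive

lemma one : IsLaplacePositive fun _ => 1 := fun N c hc => by
  simpa using hc 1 (by simp)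

lemma add {f g : ℝ → ℝ} (hf : IsLaplacePositive f) (hg : IsLaplacePositive g) :
    IsLaplacePositive fun p => f p + g p := fun N c hc => by
  simp only [mul_add, Finset.sum_add_distrib]
  exact add_nonneg (hf N c hc) (hg N c hc)

lemma const_mul {f : ℝ → ℝ} (hf : IsLaplacePositive f) {a : ℝ} (ha : 0 ≤ a) :
    IsLaplacePositive fun p => a * f p := fun N c hc => by
  have : ∑ k ∈ Finset.range N, c k * (a * f (k + 1)) =
      a * ∑ k ∈ Finset.range N, c k * f (k + 1) := by
    rw [Finset.mul_sum]
    exact Finset.sum_congr rfl fun k _ => by ring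
  rw [this]
  exact mul_nonneg ha (hf N c hc)

lemma congr {f g : ℝ → ℝ} (hf : IsLaplacePositive f) (h : ∀ p, 0 < p → g p = f p) :
    IsLaplacePositive g := fun N c hc => by
  have := hf N c hc
  simpa only [fun k : ℕ => h (k + 1) (by positivity)] using this

lemma of_tendsto {f : ℕ → ℝ → ℝ} {g : ℝ → ℝ} (hf : ∀ n, IsLaplacePositive (f n))
    (h : ∀ p, 0 < p → Filter.Tendsto (fun n => f n p) Filter.atTop (nhds (g p))) :
    IsLaplacePositive g := fun N c hc =>
  ge_of_tendsto' (tendsto_finsetSum _ fun k _ => (h (k + 1) (by positivity)).const_mul (c k))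
    fun n => hf n N c hc

/-- The nonnegative polynomial `q(X)` is replaced by `q(e^{-u} X)`, which is nonnegative too. -/
lemma exp_mul {f : ℝ → ℝ} (hf : IsLaplacePositive f) {u : ℝ} (hu : 0 ≤ u) :
    IsLaplacePositive fun p => Real.exp (-(p * u)) * f p := fun N c hc => by
  have h := hf N (fun k => c k * Real.exp (-u) ^ k) fun x hx => by
    have h1 : Real.exp (-u) ≤ 1 := Real.exp_le_one_iff.mpr (by linarith)
    have := hc (Real.exp (-u) * x) ⟨mul_nonneg (Real.exp_pos _).le hx.1,
      mul_le_one₀ h1 hx.1 hx.2⟩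
    simpa only [mul_pow, mul_assoc] using this
  have e : ∑ k ∈ Finset.range N, c k * (Real.exp (-((k + 1) * u)) * f (k + 1)) =
      Real.exp (-u) * ∑ k ∈ Finset.range N, c k * Real.exp (-u) ^ k * f (k + 1) := by
    rw [Finset.mul_sum]
    refine Finset.sum_congr rfl fun k _ => ?_
    rw [← Real.exp_nat_mul, show -((k + 1) * u) = -u + k * -u by ring, Real.exp_add]
    ring
  rw [e]
  exact mul_nonneg (Real.exp_pos _).le h

/-- The product with the Laplace transform of a nonnegative function. -/
lemma laplace_mul {f : ℝ → ℝ} (hf : IsLaplacePositive f) {w : ℝ → ℝ} {s : Set ℝ}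
    (hs : MeasurableSet s) (hs0 : ∀ u ∈ s, 0 ≤ u) (hw : ∀ u ∈ s, 0 ≤ w u)
    (hint : ∀ p, 0 < p → IntegrableOn (fun u => Real.exp (-(p * u)) * w u) s) :
    IsLaplacePositive fun p => (∫ u in s, Real.exp (-(p * u)) * w u) * f p := fun N c hc => by
  have e : ∑ k ∈ Finset.range N, c k * ((∫ u in s, Real.exp (-((k + 1 : ℝ) * u)) * w u) *
      f (k + 1)) = ∫ u in s, ∑ k ∈ Finset.range N,
        (c k * f (k + 1)) * (Real.exp (-((k + 1 : ℝ) * u)) * w u) := by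
    rw [integral_finsetSum _ fun (k : ℕ) _ => (hint (k + 1) (by positivity)).const_mul _]
    refine Finset.sum_congr rfl fun k _ => ?_
    rw [integral_const_mul]
    ring
  rw [e]
  refine setIntegral_nonneg hs fun u hu => ?_
  have := mul_nonneg (hw u hu) (hf.exp_mul (hs0 u hu) N c hc)
  rw [Finset.mul_sum] at this
  refine this.trans_eq (Finset.sum_congr rfl fun k _ => by ring)

/-- The product with the exponential of the Laplace transform of a nonnegative function. -/
lemma exp_laplace_mul {f : ℝ → ℝ} (hf : IsLaplacePositive f) {w : ℝ → ℝ} {s : Set ℝ}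
    (hs : MeasurableSet s) (hs0 : ∀ u ∈ s, 0 ≤ u) (hw : ∀ u ∈ s, 0 ≤ w u)
    (hint : ∀ p, 0 < p → IntegrableOn (fun u => Real.exp (-(p * u)) * w u) s) :
    IsLaplacePositive fun p => Real.exp (∫ u in s, Real.exp (-(p * u)) * w u) * f p := by
  set g : ℝ → ℝ := fun p => ∫ u in s, Real.exp (-(p * u)) * w u with hg
  have hpow : ∀ n : ℕ, IsLaplacePositive fun p => g p ^ n * f p := fun n => by
    induction n with
    | zero => simpa using hf
    | succ n ih => exact (ih.laplace_mul hs hs0 hw hint).congr fun p _ => by rw [pow_succ]; ring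
  have hsum : ∀ n : ℕ, IsLaplacePositive fun p =>
      (∑ m ∈ Finset.range n, g p ^ m / m.factorial) * f p := fun n => by
    induction n with
    | zero => simpa using one.const_mul le_rfl
    | succ n ih =>
      refine (ih.add ((hpow n).const_mul (a := (n.factorial : ℝ)⁻¹) (by positivity))).congr
        fun p _ => ?_
      rw [Finset.sum_range_succ]
      ring
  refine of_tendsto hsum fun p _ => Filter.Tendsto.mul_const _ ?_
  have h := (NormedSpace.expSeries_div_hasSum_exp (g p)).tendsto_sum_nat
  rwa [← Real.exp_eq_exp_ℝ] at h

end IsLaplacePositive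

/-- A continuous function with a completely monotone Laplace transform is nonnegative: by
Weierstrass approximation, the polynomials in the definition can be replaced by a bump function. -/
lemma nonneg_of_isLaplacePositive {h : ℝ → ℝ} (hc : ContinuousOn h (Set.Ioi 0))
    (hint : ∀ p, 0 < p → IntegrableOn (fun t => Real.exp (-(p * t)) * h t) (Set.Ioi 0))
    (hL : IsLaplacePositive fun p => ∫ t in Set.Ioi (0 : ℝ), Real.exp (-(p * t)) * h t)
    {t₀ : ℝ} (ht₀ : 0 < t₀) : 0 ≤ h t₀ := by
  have hint1 : IntegrableOn (fun t => Real.exp (-t) * h t) (Set.Ioi 0) := by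
    simpa using hint 1 one_pos
  have hmem : ∀ t ∈ Set.Ioi (0 : ℝ), Real.exp (-t) ∈ Set.Icc (0 : ℝ) 1 := fun t ht =>
    ⟨(Real.exp_pos _).le, Real.exp_le_one_iff.mpr (by simpa using le_of_lt ht)⟩
  have hpoly : ∀ q : Polynomial ℝ, (∀ x ∈ Set.Icc (0 : ℝ) 1, 0 ≤ q.eval x) →
      0 ≤ ∫ t in Set.Ioi (0 : ℝ), q.eval (Real.exp (-t)) * (Real.exp (-t) * h t) := by
    intro q hq
    have := hL (q.natDegree + 1) q.coeff fun x hx => by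
      rw [← Polynomial.eval_eq_sum_range]
      exact hq x hx
    refine this.trans_eq ?_
    simp only [← integral_const_mul]
    rw [← integral_finsetSum _ fun (k : ℕ) _ => (hint (k + 1) (by positivity)).const_mul _]
    refine setIntegral_congr_fun measurableSet_Ioi fun t _ => ?_
    rw [Polynomial.eval_eq_sum_range, Finset.sum_mul]
    refine Finset.sum_congr rfl fun k _ => ?_
    rw [← Real.exp_nat_mul, show -((k + 1) * t) = k * -t + -t by ring, Real.exp_add]
    ring
  have hbdd : ∀ φ : ℝ → ℝ, Continuous φ →
      IntegrableOn (fun t => φ (Real.exp (-t)) * (Real.exp (-t) * h t)) (Set.Ioi 0) := by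
    intro φ hφ
    obtain ⟨C, hC⟩ := isCompact_Icc.exists_bound_of_continuousOn
      (hφ.continuousOn (s := Set.Icc 0 1))
    refine hint1.bdd_mul (c := C) (Continuous.aestronglyMeasurable (by fun_prop)) ?_
    filter_upwards [ae_restrict_mem measurableSet_Ioi] with t ht
    exact hC _ (hmem t ht)
  have hcont : ∀ φ : ℝ → ℝ, Continuous φ → (∀ x, 0 ≤ φ x) →
      0 ≤ ∫ t in Set.Ioi (0 : ℝ), φ (Real.exp (-t)) * (Real.exp (-t) * h t) := by
    intro φ hφ hφ0
    set K := ∫ t in Set.Ioi (0 : ℝ), ‖Real.exp (-t) * h t‖ with hK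
    have hK0 : 0 ≤ K := integral_nonneg fun t => norm_nonneg _
    refine le_of_forall_pos_le_add fun δ hδ => ?_
    obtain ⟨q, hq⟩ := exists_polynomial_near_of_continuousOn 0 1
      (fun x => φ x + δ / (2 * (K + 1))) (by fun_prop) (δ / (2 * (K + 1))) (by positivity)
    have h1 := hpoly q fun x hx => by
      have := (abs_lt.mp (hq x hx)).1
      have := hφ0 x
      linarith
    refine h1.trans ?_
    have h2 : ∫ t in Set.Ioi (0 : ℝ), q.eval (Real.exp (-t)) * (Real.exp (-t) * h t) ≤
        ∫ t in Set.Ioi (0 : ℝ), (φ (Real.exp (-t)) * (Real.exp (-t) * h t) +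
          δ / (K + 1) * ‖Real.exp (-t) * h t‖) := by
      refine setIntegral_mono_on (hbdd _ q.continuous)
        ((hbdd φ hφ).add (hint1.norm.const_mul _)) measurableSet_Ioi fun t ht => ?_
      have h3 : |q.eval (Real.exp (-t)) - φ (Real.exp (-t))| ≤ δ / (K + 1) := by
        have := hq _ (hmem t ht)
        have e : δ / (K + 1) = δ / (2 * (K + 1)) + δ / (2 * (K + 1)) := by field_simp; norm_num
        have hpos : 0 < δ / (2 * (K + 1)) := by positivity
        rw [abs_lt] at this
        rw [abs_le, e]
        constructor <;> linarith
      have h4 : (q.eval (Real.exp (-t)) - φ (Real.exp (-t))) * (Real.exp (-t) * h t) ≤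
          δ / (K + 1) * ‖Real.exp (-t) * h t‖ := by
        refine (le_abs_self _).trans ?_
        rw [abs_mul, Real.norm_eq_abs]
        gcongr
      linarith
    refine h2.trans ?_
    rw [integral_add (hbdd φ hφ) (hint1.norm.const_mul _), integral_const_mul, ← hK]
    have : δ / (K + 1) * K ≤ δ := by
      rw [div_mul_eq_mul_div, div_le_iff₀ (by positivity)]
      nlinarith
    linarith
  by_contra hneg
  push Not at hneg
  have hev : ∀ᶠ t in nhds t₀, h t < 0 ∧ 0 < t :=
    ((hc.continuousAt (Ioi_mem_nhds ht₀)).eventually (gt_mem_nhds hneg)).and (lt_mem_nhds ht₀)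
  obtain ⟨a, b, hab, hsub⟩ := mem_nhds_iff_exists_Ioo_subset.mp hev
  -- this bump is positive at `e^{-t}` exactly for `t` in `(a, b)`
  set φ : ℝ → ℝ := fun x => max 0 ((Real.exp (-a) - x) * (x - Real.exp (-b))) with hφ
  have hφpos : ∀ t ∈ Set.Ioo a b, 0 < φ (Real.exp (-t)) := fun t ht => by
    have h1 : Real.exp (-t) < Real.exp (-a) := Real.exp_lt_exp.mpr (by linarith [ht.1])
    have h2 : Real.exp (-b) < Real.exp (-t) := Real.exp_lt_exp.mpr (by linarith [ht.2])
    exact lt_max_of_lt_right (mul_pos (by linarith) (by linarith))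
  have hφzero : ∀ t, t ∉ Set.Ioo a b → φ (Real.exp (-t)) = 0 := fun t ht => by
    refine max_eq_left ?_
    have hab' : a < b := hab.1.trans hab.2
    have h3 : Real.exp (-b) < Real.exp (-a) := Real.exp_lt_exp.mpr (by linarith)
    by_cases hta : a < t
    · have htb : b ≤ t := by
        by_contra hh
        exact ht ⟨hta, not_le.mp hh⟩
      have : Real.exp (-t) ≤ Real.exp (-b) := Real.exp_le_exp.mpr (by linarith)
      exact mul_nonpos_of_nonneg_of_nonpos (by linarith) (by linarith)
    · have : Real.exp (-a) ≤ Real.exp (-t) := Real.exp_le_exp.mpr (by linarith)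
      exact mul_nonpos_of_nonpos_of_nonneg (by linarith) (by linarith)
  have hφc : Continuous φ := by fun_prop
  have hge := hcont φ hφc fun x => le_max_left _ _
  have hnint : IntegrableOn (fun t => -(φ (Real.exp (-t)) * (Real.exp (-t) * h t)))
      (Set.Ioi 0) := (hbdd φ hφc).neg
  have hlt : 0 < ∫ t in Set.Ioi (0 : ℝ), -(φ (Real.exp (-t)) * (Real.exp (-t) * h t)) := by
    rw [setIntegral_pos_iff_support_of_nonneg_ae _ hnint]
    · refine lt_of_lt_of_le (b := volume (Set.Ioo a b)) ?_ (measure_mono fun t ht => ⟨?_, ?_⟩)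
      · simpa using hab.1.trans hab.2
      · have := hφpos t ht
        have h1 := (hsub ht).1
        exact neg_ne_zero.mpr (mul_ne_zero this.ne' (mul_ne_zero (Real.exp_pos _).ne' h1.ne))
      · exact (hsub ht).2
    · refine Filter.Eventually.of_forall fun t => ?_
      by_cases ht : t ∈ Set.Ioo a b
      · have h1 := hφpos t ht
        have h2 := (hsub ht).1
        have h3 := Real.exp_pos (-t)
        have : φ (Real.exp (-t)) * (Real.exp (-t) * h t) ≤ 0 :=
          mul_nonpos_of_nonneg_of_nonpos h1.le (mul_nonpos_of_nonneg_of_nonpos h3.le h2.le)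
        simpa using this
      · simp [hφzero t ht]
  rw [integral_neg] at hlt
  linarith

/-! ### Nonnegativity of the `M`-Wright function -/

lemma integrableOn_one_sub_exp_mul_rpow {β : ℝ} (hβ0 : 0 < β) (hβ1 : β < 1) {p : ℝ} (hp : 0 < p) :
    IntegrableOn (fun u : ℝ => (1 - Real.exp (-(p * u))) * u ^ (-1 - β)) (Set.Ioi 0) := by
  have hmeas : ∀ s : Set ℝ, AEStronglyMeasurable
      (fun u : ℝ => (1 - Real.exp (-(p * u))) * u ^ (-1 - β)) (volume.restrict s) :=
    fun s => Measurable.aestronglyMeasurable (by fun_prop)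
  have hnn : ∀ u : ℝ, 0 < u → 0 ≤ 1 - Real.exp (-(p * u)) := fun u hu => by
    have : Real.exp (-(p * u)) ≤ 1 := Real.exp_le_one_iff.mpr (by nlinarith)
    linarith
  rw [← Set.Ioc_union_Ioi_eq_Ioi (zero_le_one (α := ℝ))]
  refine IntegrableOn.union ?_ ?_
  · have h1 : IntegrableOn (fun u : ℝ => p * u ^ (-β)) (Set.Ioc 0 1) :=
      ((intervalIntegrable_iff_integrableOn_Ioc_of_le zero_le_one).mp
        (intervalIntegral.intervalIntegrable_rpow' (by linarith))).const_mul p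
    refine h1.mono' (hmeas _) ?_
    filter_upwards [ae_restrict_mem measurableSet_Ioc] with u hu
    have hu0 : 0 < u := hu.1
    have h2 : 1 - Real.exp (-(p * u)) ≤ p * u := by
      have := Real.add_one_le_exp (-(p * u))
      linarith
    rw [Real.norm_of_nonneg (mul_nonneg (hnn u hu0) (by positivity))]
    calc (1 - Real.exp (-(p * u))) * u ^ (-1 - β) ≤ p * u * u ^ (-1 - β) := by gcongr
      _ = p * u ^ (-β) := by
        rw [show -β = 1 + (-1 - β) by ring, Real.rpow_add hu0, Real.rpow_one]
        ring
  · refine (integrableOn_Ioi_rpow_of_lt (a := -1 - β) (by linarith) one_pos).mono' (hmeas _) ?_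
    filter_upwards [ae_restrict_mem measurableSet_Ioi] with u hu
    have hu0 : 0 < u := lt_trans one_pos hu
    rw [Real.norm_of_nonneg (mul_nonneg (hnn u hu0) (by positivity))]
    refine mul_le_of_le_one_left (by positivity) ?_
    linarith [Real.exp_pos (-(p * u))]

/-- The constant in the Lévy-Khintchine representation of `p^β`. -/
lemma integral_one_sub_exp_mul_rpow_pos {β : ℝ} (hβ0 : 0 < β) (hβ1 : β < 1) :
    0 < ∫ u in Set.Ioi (0 : ℝ), (1 - Real.exp (-u)) * u ^ (-1 - β) := by
  have hint : IntegrableOn (fun u : ℝ => (1 - Real.exp (-u)) * u ^ (-1 - β)) (Set.Ioi 0) := by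
    simpa using integrableOn_one_sub_exp_mul_rpow hβ0 hβ1 one_pos
  have hpos : ∀ u : ℝ, 0 < u → 0 < (1 - Real.exp (-u)) * u ^ (-1 - β) := fun u hu => by
    have : Real.exp (-u) < 1 := Real.exp_lt_one_iff.mpr (by linarith)
    exact mul_pos (by linarith) (by positivity)
  rw [setIntegral_pos_iff_support_of_nonneg_ae _ hint]
  · refine lt_of_lt_of_le (b := volume (Set.Ioi (0 : ℝ))) (by simp)
      (measure_mono fun u hu => ⟨(hpos u hu).ne', hu⟩)
  · filter_upwards [ae_restrict_mem measurableSet_Ioi] with u hu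
    exact (hpos u hu).le

/-- The Lévy-Khintchine representation of `p^β`. -/
lemma integral_one_sub_exp_mul_rpow (β : ℝ) {p : ℝ} (hp : 0 < p) :
    ∫ u in Set.Ioi (0 : ℝ), (1 - Real.exp (-(p * u))) * u ^ (-1 - β) =
      p ^ β * ∫ u in Set.Ioi (0 : ℝ), (1 - Real.exp (-u)) * u ^ (-1 - β) := by
  have h := integral_comp_mul_left_Ioi (fun u : ℝ => (1 - Real.exp (-u)) * u ^ (-1 - β)) 0 hp
  rw [mul_zero, smul_eq_mul] at h
  have e : ∫ u in Set.Ioi (0 : ℝ), (1 - Real.exp (-(p * u))) * u ^ (-1 - β) =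
      ∫ u in Set.Ioi (0 : ℝ), p ^ (1 + β) * ((1 - Real.exp (-(p * u))) * (p * u) ^ (-1 - β)) := by
    refine setIntegral_congr_fun measurableSet_Ioi fun u hu => ?_
    have hu0 : (0 : ℝ) < u := hu
    have h1 : p ^ (1 + β) * p ^ (-1 - β) = 1 := by
      rw [← Real.rpow_add hp]
      simp
    rw [Real.mul_rpow hp.le hu0.le]
    linear_combination -((1 - Real.exp (-(p * u))) * u ^ (-1 - β)) * h1
  rw [e, integral_const_mul, h, Real.rpow_add hp, Real.rpow_one]
  field_simp

lemma isLaplacePositive_rpow {β : ℝ} (hβ1 : β < 1) :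
    IsLaplacePositive fun p => p ^ (β - 1) := by
  have hint : ∀ p : ℝ, 0 < p →
      IntegrableOn (fun u => Real.exp (-(p * u)) * u ^ ((1 - β) - 1)) (Set.Ioi 0) := fun p hp => by
    simpa only [mul_comm] using integrableOn_rpow_mul_exp_neg (s := 1 - β) (by linarith) hp
  have hΓ : 0 < Real.Gamma (1 - β) := Real.Gamma_pos_of_pos (by linarith)
  refine ((IsLaplacePositive.one.laplace_mul measurableSet_Ioi (fun u hu => le_of_lt hu)
    (fun u hu => Real.rpow_nonneg (le_of_lt hu) _) hint).const_mul
      (inv_nonneg.mpr hΓ.le)).congr fun p hp => ?_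
  have := Real.integral_rpow_mul_exp_neg_mul_Ioi (a := 1 - β) (r := p) (by linarith) hp
  simp only [mul_comm (Real.exp _)]
  rw [this, one_div, Real.inv_rpow hp.le, ← Real.rpow_neg hp.le, neg_sub]
  field_simp

/-- `p^{β-1} e^{-r p^β}` is completely monotone: the exponent is the limit for `ε → 0` of
`∫_ε^∞ (1 - e^{-pu}) u^{-1-β} du`, which is a constant minus a Laplace transform. -/
lemma isLaplacePositive_rpow_mul_exp {β : ℝ} (hβ0 : 0 < β) (hβ1 : β < 1) {r : ℝ} (hr : 0 ≤ r) :
    IsLaplacePositive fun p => p ^ (β - 1) * Real.exp (-(r * p ^ β)) := by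
  set C := ∫ u in Set.Ioi (0 : ℝ), (1 - Real.exp (-u)) * u ^ (-1 - β) with hC
  have hC0 : 0 < C := integral_one_sub_exp_mul_rpow_pos hβ0 hβ1
  set s : ℕ → Set ℝ := fun n => Set.Ioi (1 / ((n : ℝ) + 1)) with hs
  have hspos : ∀ n : ℕ, (0 : ℝ) < 1 / ((n : ℝ) + 1) := fun n => Nat.one_div_pos_of_nat
  have hint0 : ∀ n, IntegrableOn (fun u : ℝ => u ^ (-1 - β)) (s n) := fun n =>
    integrableOn_Ioi_rpow_of_lt (by linarith) (hspos n)
  have hint : ∀ n (p : ℝ), 0 < p →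
      IntegrableOn (fun u => Real.exp (-(p * u)) * (r / C * u ^ (-1 - β))) (s n) :=
    fun n p hp => by
      refine ((hint0 n).const_mul (r / C)).bdd_mul (c := 1)
        (Measurable.aestronglyMeasurable (by fun_prop)) ?_
      filter_upwards [ae_restrict_mem measurableSet_Ioi] with u hu
      have hu0 : (0 : ℝ) < u := (hspos n).trans hu
      rw [Real.norm_of_nonneg (Real.exp_pos _).le]
      exact Real.exp_le_one_iff.mpr (by nlinarith)
  refine IsLaplacePositive.of_tendsto (f := fun n p =>
    Real.exp (-∫ u in s n, r / C * u ^ (-1 - β)) *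
      (Real.exp (∫ u in s n, Real.exp (-(p * u)) * (r / C * u ^ (-1 - β))) * p ^ (β - 1)))
    (fun n => ((isLaplacePositive_rpow hβ1).exp_laplace_mul measurableSet_Ioi
      (fun u hu => ((hspos n).trans hu).le) (fun u hu => ?_) (hint n)).const_mul
        (Real.exp_pos _).le) fun p hp => ?_
  · have hu0 : (0 : ℝ) < u := (hspos n).trans hu
    positivity
  · have hunion : ⋃ n, s n = Set.Ioi 0 := by
      ext u
      simp only [hs, Set.mem_iUnion, Set.mem_Ioi]
      exact ⟨fun ⟨n, hn⟩ => (hspos n).trans hn, fun hu => exists_nat_one_div_lt hu⟩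
    have hmono : Monotone s := fun m n hmn => Set.Ioi_subset_Ioi
      (one_div_le_one_div_of_le (by positivity) (by gcongr))
    have hlim := tendsto_setIntegral_of_monotone (μ := volume)
      (f := fun u : ℝ => (1 - Real.exp (-(p * u))) * u ^ (-1 - β))
      (fun n => measurableSet_Ioi) hmono
      (by rw [hunion]; exact integrableOn_one_sub_exp_mul_rpow hβ0 hβ1 hp)
    rw [hunion, integral_one_sub_exp_mul_rpow β hp, ← hC] at hlim
    have hlim2 := ((Real.continuous_exp.tendsto _).comp (hlim.const_mul (-(r / C)))).mul_const
      (p ^ (β - 1))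
    have e : Real.exp (-(r / C) * (p ^ β * C)) * p ^ (β - 1) =
        p ^ (β - 1) * Real.exp (-(r * p ^ β)) := by
      rw [show -(r / C) * (p ^ β * C) = -(r * p ^ β) by field_simp]
      ring
    rw [e] at hlim2
    refine hlim2.congr fun n => ?_
    simp only [Function.comp]
    rw [← mul_assoc, ← Real.exp_add, ← integral_const_mul, ← sub_eq_neg_add,
      ← integral_sub (hint n p hp) ((hint0 n).const_mul _)]
    congr 2
    refine setIntegral_congr_fun measurableSet_Ioi fun u _ => ?_
    ring

lemma continuousOn_rpow_mul_mWright_left {β : ℝ} (hβ0 : 0 < β) (hβ1 : β < 1) {r : ℝ}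
    (hr : 0 < r) :
    ContinuousOn (fun t : ℝ => t ^ (-β) * mWright β (t ^ (-β) * r)) (Set.Ioi 0) :=
  (continuousOn_rpow_mul_mWright hβ0 hβ1).comp (f := fun t : ℝ => (t, r))
    (by fun_prop) fun t ht => ⟨ht, hr⟩

lemma integrableOn_laplace_mWright {β : ℝ} (hβ0 : 0 < β) (hβ1 : β < 1) {r p : ℝ} (hr : 0 < r)
    (hp : 0 < p) :
    IntegrableOn (fun t : ℝ => Real.exp (-(p * t)) * (t ^ (-β) * mWright β (t ^ (-β) * r)))
      (Set.Ioi 0) := by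
  obtain ⟨C, hC⟩ := exists_abs_mWright_le hβ0 hβ1
  refine ((integrableOn_rpow_mul_exp_neg (s := 1 - β) (by linarith) hp).mul_const C).mono'
    (AEStronglyMeasurable.mul (Measurable.aestronglyMeasurable (by fun_prop))
      ((continuousOn_rpow_mul_mWright_left hβ0 hβ1 hr).aestronglyMeasurable measurableSet_Ioi)) ?_
  filter_upwards [ae_restrict_mem measurableSet_Ioi] with t ht
  have ht' : (0 : ℝ) < t ^ (-β) := Real.rpow_pos_of_pos ht _
  rw [Real.norm_eq_abs, abs_mul, abs_mul, abs_of_pos ht', abs_of_pos (Real.exp_pos _),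
    show (1 - β) - 1 = -β by ring, mul_comm (t ^ (-β)) (Real.exp _), mul_assoc]
  gcongr
  exact hC _ (by positivity)

/-- `M_β` is nonnegative, since `t ↦ t^{-β} M_β(r t^{-β})` has a completely monotone Laplace
transform. -/
lemma mWright_nonneg {β : ℝ} (hβ0 : 0 < β) (hβ1 : β < 1) {r : ℝ} (hr : 0 < r) :
    0 ≤ mWright β r := by
  have h := nonneg_of_isLaplacePositive (continuousOn_rpow_mul_mWright_left hβ0 hβ1 hr)
    (fun p hp => integrableOn_laplace_mWright hβ0 hβ1 hr hp)
    ((isLaplacePositive_rpow_mul_exp hβ0 hβ1 hr.le).congr fun p hp =>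
      laplace_mWright hβ0 hβ1 hr hp) one_pos
  simpa using h

/-! ### Moments of the `M`-Wright function and the Mittag-Leffler function -/

lemma integrable_moment_subordination {β : ℝ} (hβ0 : 0 < β) (hβ1 : β < 1) (n : ℕ) :
    Integrable (fun p : ℝ × ℝ => p.2 ^ n * (Real.exp (-p.1) *
      (p.1 ^ (-β) * mWright β (p.1 ^ (-β) * p.2))))
      ((volume.restrict (Set.Ioi (0 : ℝ))).prod (volume.restrict (Set.Ioi (0 : ℝ)))) := by
  have hmeas : AEStronglyMeasurable (fun p : ℝ × ℝ => p.2 ^ n * (Real.exp (-p.1) *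
      (p.1 ^ (-β) * mWright β (p.1 ^ (-β) * p.2))))
      ((volume.restrict (Set.Ioi (0 : ℝ))).prod (volume.restrict (Set.Ioi (0 : ℝ)))) := by
    rw [Measure.prod_restrict]
    refine ContinuousOn.aestronglyMeasurable ?_ (measurableSet_Ioi.prod measurableSet_Ioi)
    exact ContinuousOn.mul (by fun_prop)
      (ContinuousOn.mul (by fun_prop) (continuousOn_rpow_mul_mWright hβ0 hβ1))
  refine (integrable_prod_iff' hmeas).mpr ⟨?_, ?_⟩
  · filter_upwards [ae_restrict_mem measurableSet_Ioi] with r hr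
    have := (integrableOn_laplace_mWright hβ0 hβ1 hr one_pos).const_mul (r ^ n)
    simpa using this
  · refine (integrableOn_rpow_mul_exp_neg (s := n + 1) (b := 1) (by positivity) one_pos).congr ?_
    filter_upwards [ae_restrict_mem measurableSet_Ioi] with r hr
    have hr0 : (0 : ℝ) < r := hr
    have e : ∫ t in Set.Ioi (0 : ℝ), ‖r ^ n * (Real.exp (-t) *
        (t ^ (-β) * mWright β (t ^ (-β) * r)))‖ = ∫ t in Set.Ioi (0 : ℝ), r ^ n *
          (Real.exp (-t) * (t ^ (-β) * mWright β (t ^ (-β) * r))) := by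
      refine setIntegral_congr_fun measurableSet_Ioi fun t ht => ?_
      have ht' : (0 : ℝ) < t ^ (-β) := Real.rpow_pos_of_pos ht _
      have := mWright_nonneg hβ0 hβ1 (mul_pos ht' hr0)
      exact Real.norm_of_nonneg (by positivity)
    rw [e, integral_const_mul, integral_exp_mul_mWright hβ0 hβ1 hr]
    simp

lemma integrableOn_pow_mul_mWright {β : ℝ} (hβ0 : 0 < β) (hβ1 : β < 1) (n : ℕ) :
    IntegrableOn (fun r => r ^ n * mWright β r) (Set.Ioi 0) := by
  -- almost every section of the double integral is, up to scaling, the claim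
  have h := (integrable_moment_subordination hβ0 hβ1 n).prod_right_ae
  obtain ⟨t, ht, hI⟩ : ∃ t : ℝ, 0 < t ∧ IntegrableOn (fun r => r ^ n * (Real.exp (-t) *
      (t ^ (-β) * mWright β (t ^ (-β) * r)))) (Set.Ioi 0) := by
    have h' := h.and (ae_restrict_mem measurableSet_Ioi)
    have : (ae (volume.restrict (Set.Ioi (0 : ℝ)))).NeBot := by
      rw [ae_neBot, Ne, Measure.restrict_eq_zero]
      simp
    obtain ⟨t, h1, h2⟩ := h'.exists
    exact ⟨t, h2, h1⟩
  set a := t ^ (-β) with ha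
  have ha0 : 0 < a := Real.rpow_pos_of_pos ht _
  have h2 : IntegrableOn (fun r => (a * r) ^ n * mWright β (a * r)) (Set.Ioi 0) := by
    refine (hI.const_mul (a ^ n / (Real.exp (-t) * a))).congr
      (Filter.Eventually.of_forall fun r => ?_)
    simp only
    have := Real.exp_pos (-t)
    field_simp
    ring
  have h3 := (integrableOn_Ioi_comp_mul_left_iff (fun r => r ^ n * mWright β r) 0 ha0).mp h2
  rwa [mul_zero] at h3

/-- The moments of the density `M_β`. -/
lemma integral_pow_mul_mWright {β : ℝ} (hβ0 : 0 < β) (hβ1 : β < 1) (n : ℕ) :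
    ∫ r in Set.Ioi (0 : ℝ), r ^ n * mWright β r = n.factorial / Real.Gamma (β * n + 1) := by
  have hswap := integral_integral_swap (f := fun t r : ℝ => r ^ n * (Real.exp (-t) *
      (t ^ (-β) * mWright β (t ^ (-β) * r)))) (integrable_moment_subordination hβ0 hβ1 n)
  have hR : ∫ r in Set.Ioi (0 : ℝ), ∫ t in Set.Ioi (0 : ℝ), r ^ n * (Real.exp (-t) *
      (t ^ (-β) * mWright β (t ^ (-β) * r))) = n.factorial := by
    rw [← Real.Gamma_nat_eq_factorial, Real.Gamma_eq_integral (by positivity)]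
    refine setIntegral_congr_fun measurableSet_Ioi fun r hr => ?_
    rw [integral_const_mul, integral_exp_mul_mWright hβ0 hβ1 hr]
    simp [mul_comm]
  have hLft : ∫ t in Set.Ioi (0 : ℝ), ∫ r in Set.Ioi (0 : ℝ), r ^ n * (Real.exp (-t) *
      (t ^ (-β) * mWright β (t ^ (-β) * r))) =
      Real.Gamma (β * n + 1) * ∫ r in Set.Ioi (0 : ℝ), r ^ n * mWright β r := by
    rw [Real.Gamma_eq_integral (by positivity), ← integral_mul_const]
    refine setIntegral_congr_fun measurableSet_Ioi fun t ht => ?_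
    have ht0 : (0 : ℝ) < t := ht
    set a := t ^ (-β) with ha
    have ha0 : 0 < a := Real.rpow_pos_of_pos ht _
    have h := integral_comp_mul_left_Ioi (fun r => r ^ n * mWright β r) 0 ha0
    rw [mul_zero, smul_eq_mul] at h
    have e : t ^ (β * n + 1 - 1) = (a ^ n)⁻¹ := by
      rw [ha, ← Real.rpow_mul_natCast ht0.le, ← Real.rpow_neg ht0.le]
      ring_nf
    rw [e]
    calc ∫ r in Set.Ioi (0 : ℝ), r ^ n * (Real.exp (-t) * (a * mWright β (a * r)))
        = ∫ r in Set.Ioi (0 : ℝ), (Real.exp (-t) * a * (a ^ n)⁻¹) *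
          ((a * r) ^ n * mWright β (a * r)) := by
          refine setIntegral_congr_fun measurableSet_Ioi fun r _ => ?_
          field_simp
          ring
      _ = _ := by
          rw [integral_const_mul, h]
          field_simp
  have hΓ : 0 < Real.Gamma (β * n + 1) := Real.Gamma_pos_of_pos (by positivity)
  rw [hLft, hR] at hswap
  rw [eq_div_iff hΓ.ne', mul_comm]
  exact hswap

lemma rpow_mul_exp_neg_le_Gamma {s T : ℝ} (hs : 0 ≤ s) (hT : 0 ≤ T) :
    T ^ s * Real.exp (-T) ≤ Real.Gamma (s + 1) := by
  have h1 := Real.GammaIntegral_convergent (s := s + 1) (by linarith)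
  rw [Real.Gamma_eq_integral (by linarith), ← integral_exp_neg_Ioi, ← integral_const_mul]
  refine (setIntegral_mono_on ((integrableOn_exp_neg_Ioi T).const_mul _)
    (h1.mono_set (Set.Ioi_subset_Ioi hT)) measurableSet_Ioi fun t ht => ?_).trans
    (setIntegral_mono_set h1 ?_ (Set.Ioi_subset_Ioi hT).eventuallyLE)
  · have ht' : T < t := ht
    rw [add_sub_cancel_right, mul_comm]
    gcongr
  · filter_upwards [ae_restrict_mem measurableSet_Ioi] with t ht
    have ht' : (0 : ℝ) < t := ht
    simp only [Pi.zero_apply]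
    positivity

/-- The Mittag-Leffler series has infinite radius of convergence. -/
lemma summable_pow_div_Gamma {β : ℝ} (hβ0 : 0 < β) {s : ℝ} (hs : 0 ≤ s) :
    Summable fun n : ℕ => s ^ n / Real.Gamma (β * n + 1) := by
  -- with `T^β = 2 s + 1`, the bound `Γ(β n + 1) ≥ T^{β n} e^{-T}` gives a geometric series
  set T : ℝ := (2 * s + 1) ^ (1 / β) with hT
  have hT0 : 0 ≤ T := by positivity
  have hTβ : T ^ β = 2 * s + 1 := by
    rw [hT, ← Real.rpow_mul (by positivity), one_div, inv_mul_cancel₀ hβ0.ne', Real.rpow_one]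
  refine Summable.of_nonneg_of_le (fun n => ?_) (fun n => ?_)
    ((summable_geometric_of_lt_one (r := (1 : ℝ) / 2) (by norm_num) (by norm_num)).mul_left
      (Real.exp T))
  · have : 0 < Real.Gamma (β * n + 1) := Real.Gamma_pos_of_pos (by positivity)
    positivity
  · have h := rpow_mul_exp_neg_le_Gamma (s := β * n) (by positivity) hT0
    rw [Real.rpow_mul hT0, hTβ, Real.rpow_natCast] at h
    have hpos : 0 < (2 * s + 1) ^ n * Real.exp (-T) := by positivity
    calc s ^ n / Real.Gamma (β * n + 1) ≤ s ^ n / ((2 * s + 1) ^ n * Real.exp (-T)) := by gcongr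
      _ = Real.exp T * (s / (2 * s + 1)) ^ n := by
        rw [Real.exp_neg, div_pow]
        field_simp
      _ ≤ Real.exp T * (1 / 2) ^ n := by
        refine mul_le_mul_of_nonneg_left (pow_le_pow_left₀ (by positivity) ?_ n) (by positivity)
        rw [div_le_div_iff₀ (by positivity) (by norm_num)]
        linarith

lemma mittagLeffler_ofReal (β s : ℝ) :
    mittagLeffler β (s : ℂ) = ((∑' n : ℕ, s ^ n / Real.Gamma (β * n + 1) : ℝ) : ℂ) := by
  rw [mittagLeffler, Complex.ofReal_tsum]
  refine tsum_congr fun n => ?_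
  push_cast [← Complex.Gamma_ofReal]
  rfl

lemma integrableOn_mWright {β : ℝ} (hβ0 : 0 < β) (hβ1 : β < 1) :
    IntegrableOn (mWright β) (Set.Ioi 0) := by
  simpa using integrableOn_pow_mul_mWright hβ0 hβ1 0

/-- The Mittag-Leffler function is the Laplace transform of `M_β`. -/
lemma mittagLeffler_neg_eq_laplace {β : ℝ} (hβ0 : 0 < β) (hβ1 : β < 1) (s : ℝ) :
    mittagLeffler β ((-s : ℝ) : ℂ) =
      ((∫ r in Set.Ioi (0 : ℝ), Real.exp (-(s * r)) * mWright β r : ℝ) : ℂ) := by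
  have hF : ∀ (c : ℝ) (n : ℕ), IntegrableOn (fun r : ℝ => c ^ n / n.factorial *
      (r ^ n * mWright β r)) (Set.Ioi 0) := fun c n =>
    (integrableOn_pow_mul_mWright hβ0 hβ1 n).const_mul _
  have hI : ∀ (c : ℝ) (n : ℕ), ∫ r in Set.Ioi (0 : ℝ), c ^ n / n.factorial *
      (r ^ n * mWright β r) = c ^ n / Real.Gamma (β * n + 1) := fun c n => by
    rw [integral_const_mul, integral_pow_mul_mWright hβ0 hβ1]
    have : (n.factorial : ℝ) ≠ 0 := by positivity
    field_simp
  have key := hasSum_integral_of_summable_integral_norm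
    (μ := volume.restrict (Set.Ioi (0 : ℝ))) (hF (-s)) (by
      refine (summable_pow_div_Gamma hβ0 (abs_nonneg s)).congr fun n => ?_
      rw [← hI]
      refine setIntegral_congr_fun measurableSet_Ioi fun r hr => ?_
      have hr0 : (0 : ℝ) < r := hr
      have hM := mWright_nonneg hβ0 hβ1 hr0
      rw [norm_mul, norm_div, norm_pow, norm_neg, Real.norm_of_nonneg
        (mul_nonneg (pow_nonneg hr0.le n) hM), Real.norm_eq_abs]
      simp)
  simp only [hI] at key
  rw [mittagLeffler_ofReal, key.tsum_eq]
  congr 1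
  refine setIntegral_congr_fun measurableSet_Ioi fun r _ => ?_
  have h := (NormedSpace.expSeries_div_hasSum_exp (-(s * r))).mul_right (mWright β r)
  rw [← Real.exp_eq_exp_ℝ] at h
  rw [← h.tsum_eq]
  refine tsum_congr fun n => ?_
  rw [← neg_mul, mul_pow]
  ring

lemma integral_mWright {β : ℝ} (hβ0 : 0 < β) (hβ1 : β < 1) :
    ∫ r in Set.Ioi (0 : ℝ), mWright β r = 1 := by
  simpa using integral_pow_mul_mWright hβ0 hβ1 0

lemma continuousOn_mittagLeffler_neg {β : ℝ} (hβ0 : 0 < β) (hβ1 : β < 1) :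
    ContinuousOn (fun s : ℝ => mittagLeffler β ((-s : ℝ) : ℂ)) (Set.Ici 0) := by
  simp only [mittagLeffler_neg_eq_laplace hβ0 hβ1]
  refine Complex.continuous_ofReal.comp_continuousOn (continuousOn_of_dominated
    (fun s _ => AEStronglyMeasurable.mul (Measurable.aestronglyMeasurable (by fun_prop))
      (integrableOn_mWright hβ0 hβ1).aestronglyMeasurable) (fun s hs => ?_)
    (integrableOn_mWright hβ0 hβ1) (Filter.Eventually.of_forall fun r =>
      Continuous.continuousOn (by fun_prop)))
  filter_upwards [ae_restrict_mem measurableSet_Ioi] with r hr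
  have hr0 : (0 : ℝ) < r := hr
  have hs0 : 0 ≤ s := hs
  have hM := mWright_nonneg hβ0 hβ1 hr0
  rw [Real.norm_of_nonneg (by positivity)]
  exact mul_le_of_le_one_left hM (Real.exp_le_one_iff.mpr (by
    have : 0 ≤ s * r := by positivity
    linarith))

/-! ### Discretization of the Ornstein-Uhlenbeck equation -/

/-- If `z = -x ∫ z + b`, then the sums `∑ e^{-x(t - t_i)} (b(t_{i+1}) - b(t_i))` over the uniform
partitions of `[0, t]` converge to `z t`. Summation by parts replaces the increments of `b` by those
of `z`, up to an error governed by the modulus of continuity of `z`. -/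
lemma tendsto_sum_exp_smul_sub {E : Type*} [NormedAddCommGroup E] [NormedSpace ℝ E]
    [CompleteSpace E] {x t : ℝ} (hx : 0 ≤ x) (ht : 0 < t) {z b : ℝ → E}
    (hz : ContinuousOn z (Set.Ici 0)) (hz0 : z 0 = 0)
    (heq : ∀ s, 0 ≤ s → z s = -(x • ∫ u in (0 : ℝ)..s, z u) + b s) :
    Filter.Tendsto (fun n : ℕ => ∑ i ∈ Finset.range (n + 1),
      Real.exp (-(x * (t - i * (t / (n + 1))))) • (b ((i + 1 : ℕ) * (t / (n + 1))) -
        b (i * (t / (n + 1))))) Filter.atTop (nhds (z t)) := by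
  have hint : ∀ a c : ℝ, 0 ≤ a → 0 ≤ c → IntervalIntegrable z volume a c := fun a c ha hc =>
    (hz.mono fun u hu => by
      rcases Set.mem_uIcc.mp hu with h | h
      · exact ha.trans h.1
      · exact hc.trans h.1).intervalIntegrable
  have hsub : Set.Icc 0 t ⊆ Set.Ici 0 := Set.Icc_subset_Ici_self
  obtain ⟨K, hK⟩ := isCompact_Icc.exists_bound_of_continuousOn
    (hz.mono hsub)
  have hK0 : 0 ≤ K := (norm_nonneg _).trans (hK 0 ⟨le_rfl, ht.le⟩)
  have huc := isCompact_Icc.uniformContinuousOn_of_continuous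
    (hz.mono hsub)
  rw [Metric.uniformContinuousOn_iff] at huc
  rw [Metric.tendsto_nhds]
  intro ε hε
  obtain ⟨η, hη0, hη⟩ := huc (ε / (2 * (x * t + 1))) (by positivity)
  have hlim : Filter.Tendsto (fun n : ℕ => t / ((n : ℝ) + 1)) Filter.atTop (nhds 0) := by
    have := (tendsto_one_div_add_atTop_nhds_zero_nat (𝕜 := ℝ)).const_mul t
    simpa [div_eq_mul_inv] using this
  have hlim1 : Filter.Tendsto (fun n : ℕ => x * (t / ((n : ℝ) + 1))) Filter.atTop (nhds 0) := by
    simpa using hlim.const_mul x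
  have hlim2 : Filter.Tendsto (fun n : ℕ => x ^ 2 * t * K * (t / ((n : ℝ) + 1))) Filter.atTop
      (nhds 0) := by
    simpa using hlim.const_mul (x ^ 2 * t * K)
  filter_upwards [hlim.eventually (gt_mem_nhds hη0), hlim1.eventually (gt_mem_nhds one_pos),
    hlim2.eventually (gt_mem_nhds (half_pos hε))] with n hn1 hn2 hn3
  set h : ℝ := t / ((n : ℝ) + 1) with hh
  have hh0 : 0 < h := by positivity
  have hnh : ((n + 1 : ℕ) : ℝ) * h = t := by
    rw [hh]; push_cast; field_simp
  set w : ℕ → ℝ := fun i => Real.exp (-(x * (t - i * h))) with hw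
  have hwsucc : ∀ i, w (i + 1) = w i * Real.exp (x * h) := fun i => by
    rw [hw, ← Real.exp_add]
    push_cast
    ring_nf
  have hle : ∀ i : ℕ, i ≤ n + 1 → (i : ℝ) * h ≤ t := fun i hi => by
    rw [← hnh]
    gcongr
  have hw1 : ∀ i : ℕ, i ≤ n + 1 → w i ≤ 1 := fun i hi => by
    refine Real.exp_le_one_iff.mpr ?_
    have : 0 ≤ x * (t - i * h) := mul_nonneg hx (sub_nonneg.mpr (hle i hi))
    linarith
  -- the error on each cell of the partition
  set r : ℕ → E := fun i => (Real.exp (x * h) - 1 - x * h) • z ((i + 1 : ℕ) * h) +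
    x • ∫ u in (i * h)..((i + 1 : ℕ) * h), (z ((i + 1 : ℕ) * h) - z u) with hr
  have hstep : ∀ i : ℕ, w i • (b ((i + 1 : ℕ) * h) - b (i * h)) =
      (w (i + 1) • z ((i + 1 : ℕ) * h) - w i • z (i * h)) - w i • r i := by
    intro i
    have hi0 : (0 : ℝ) ≤ i * h := by positivity
    have hi1 : (0 : ℝ) ≤ (i + 1 : ℕ) * h := by positivity
    have e1 := heq _ hi0
    have e2 := heq _ hi1
    have e3 := intervalIntegral.integral_add_adjacent_intervals
      (hint 0 _ le_rfl hi0) (hint _ _ hi0 hi1)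
    have e4 : ∫ u in (i * h)..((i + 1 : ℕ) * h), (z ((i + 1 : ℕ) * h) - z u) =
        h • z ((i + 1 : ℕ) * h) - ∫ u in (i * h)..((i + 1 : ℕ) * h), z u := by
      rw [intervalIntegral.integral_sub intervalIntegrable_const (hint _ _ hi0 hi1),
        intervalIntegral.integral_const]
      congr 2
      push_cast
      ring
    have e5 : b ((i + 1 : ℕ) * h) - b (i * h) = z ((i + 1 : ℕ) * h) - z (i * h) +
        x • ∫ u in (i * h)..((i + 1 : ℕ) * h), z u := by
      rw [← sub_eq_iff_eq_add'.mpr e3.symm, eq_sub_of_add_eq' e2.symm, eq_sub_of_add_eq' e1.symm]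
      module
    rw [hr, e5, hwsucc]
    simp only [e4]
    module
  have hrle : ∀ i ∈ Finset.range (n + 1), ‖w i • r i‖ ≤
      (x * h) ^ 2 * K + x * (ε / (2 * (x * t + 1)) * h) := by
    intro i hi
    have hi' : i + 1 ≤ n + 1 := Finset.mem_range.mp hi
    have hi0 : (0 : ℝ) ≤ i * h := by positivity
    have hi1 : (0 : ℝ) ≤ (i + 1 : ℕ) * h := by positivity
    have hlen : ((i + 1 : ℕ) : ℝ) * h - i * h = h := by push_cast; ring
    have b1 : ‖(Real.exp (x * h) - 1 - x * h) • z ((i + 1 : ℕ) * h)‖ ≤ (x * h) ^ 2 * K := by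
      rw [norm_smul, Real.norm_eq_abs]
      have hxh : |x * h| ≤ 1 := by
        rw [abs_of_nonneg (by positivity)]
        exact hn2.le
      exact mul_le_mul (Real.abs_exp_sub_one_sub_id_le hxh) (hK _ ⟨hi1, hle _ hi'⟩)
        (norm_nonneg _) (by positivity)
    have b2 : ‖∫ u in (i * h)..((i + 1 : ℕ) * h), (z ((i + 1 : ℕ) * h) - z u)‖ ≤
        ε / (2 * (x * t + 1)) * h := by
      have := intervalIntegral.norm_integral_le_of_norm_le_const (a := i * h)
        (b := (i + 1 : ℕ) * h) (C := ε / (2 * (x * t + 1)))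
        (f := fun u => z ((i + 1 : ℕ) * h) - z u) fun u hu => by
          rw [Set.uIoc_of_le (by linarith)] at hu
          rw [← dist_eq_norm]
          refine (hη _ ⟨hi1, hle _ hi'⟩ _ ⟨hi0.trans hu.1.le, hu.2.trans (hle _ hi')⟩ ?_).le
          rw [Real.dist_eq, abs_of_nonneg (by linarith [hu.2])]
          linarith [hu.1]
      rwa [hlen, abs_of_pos hh0] at this
    rw [norm_smul, Real.norm_of_nonneg (Real.exp_pos _).le]
    refine (mul_le_of_le_one_left (norm_nonneg _) (hw1 i (by omega))).trans ?_
    refine (norm_add_le _ _).trans (add_le_add b1 ?_)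
    rw [norm_smul, Real.norm_of_nonneg hx]
    gcongr
  have hsum : ∑ i ∈ Finset.range (n + 1), w i • (b ((i + 1 : ℕ) * h) - b (i * h)) =
      z t - ∑ i ∈ Finset.range (n + 1), w i • r i := by
    rw [Finset.sum_congr rfl fun i _ => hstep i, Finset.sum_sub_distrib,
      Finset.sum_range_sub (fun i : ℕ => w i • z (i * h)), hnh]
    have : w (n + 1) = 1 := by
      simp only [hw, hnh, sub_self, mul_zero, neg_zero, Real.exp_zero]
    rw [this]
    simp [hz0]
  change dist (∑ i ∈ Finset.range (n + 1), w i • (b ((i + 1 : ℕ) * h) - b (i * h))) (z t) < ε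
  rw [hsum, dist_eq_norm, sub_sub_cancel_left, norm_neg]
  refine (norm_sum_le_of_le _ hrle).trans_lt ?_
  rw [Finset.sum_const, Finset.card_range, nsmul_eq_mul]
  have e : ((n + 1 : ℕ) : ℝ) * ((x * h) ^ 2 * K + x * (ε / (2 * (x * t + 1)) * h)) =
      x ^ 2 * (((n + 1 : ℕ) : ℝ) * h) * K * h +
        x * (((n + 1 : ℕ) : ℝ) * h) * (ε / (2 * (x * t + 1))) := by ring
  rw [e, hnh]
  have h4 : x * t * (ε / (2 * (x * t + 1))) ≤ ε / 2 := by
    rw [mul_div_assoc', div_le_div_iff₀ (by positivity) (by norm_num)]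
    nlinarith [mul_nonneg hx ht.le]
  linarith

/-- Summation over the increments of a sequence, as a linear combination of its values. -/
lemma sum_incrementCoeff_mul (N : ℕ) (w f : ℕ → ℝ) :
    ∑ j ∈ Finset.range (N + 1), (∑ i ∈ Finset.range N,
      w i * ((if j = i + 1 then 1 else 0) - (if j = i then 1 else 0))) * f j =
      ∑ i ∈ Finset.range N, w i * (f (i + 1) - f i) := by
  simp only [Finset.sum_mul]
  rw [Finset.sum_comm]
  refine Finset.sum_congr rfl fun i hi => ?_
  have hi' : i < N := Finset.mem_range.mp hi
  have e : ∀ j, w i * ((if j = i + 1 then 1 else 0) - (if j = i then 1 else 0)) * f j =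
      w i * ((if j = i + 1 then f j else 0) - (if j = i then f j else 0)) := fun j => by
    split_ifs <;> ring
  simp only [e]
  rw [← Finset.mul_sum, Finset.sum_sub_distrib, Finset.sum_ite_eq', Finset.sum_ite_eq',
    if_pos (by simp; omega), if_pos (by simp; omega)]

/-- The increments of Brownian motion over the cells of a uniform partition are uncorrelated. -/
lemma second_difference_covariance {h : ℝ} (hh : 0 ≤ h) (i m : ℕ) :
    (1 / 2 * ((i + 1 : ℕ) * h + (m + 1 : ℕ) * h - |(i + 1 : ℕ) * h - (m + 1 : ℕ) * h|) -
      1 / 2 * ((i + 1 : ℕ) * h + m * h - |(i + 1 : ℕ) * h - m * h|)) -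
    (1 / 2 * (i * h + (m + 1 : ℕ) * h - |i * h - (m + 1 : ℕ) * h|) -
      1 / 2 * (i * h + m * h - |i * h - m * h|)) = if i = m then h else 0 := by
  simp only [← sub_mul, abs_mul, abs_of_nonneg hh]
  push_cast
  rcases lt_trichotomy i m with hlt | rfl | hgt
  · have h1 : (i : ℝ) + 1 ≤ m := by exact_mod_cast hlt
    rw [if_neg hlt.ne, abs_of_nonpos (by linarith), abs_of_nonpos (by linarith),
      abs_of_nonpos (by linarith), abs_of_nonpos (by linarith)]
    ring
  · rw [if_pos rfl]
    simp
    ring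
  · have h1 : (m : ℝ) + 1 ≤ i := by exact_mod_cast hgt
    rw [if_neg hgt.ne', abs_of_nonneg (by linarith), abs_of_nonneg (by linarith),
      abs_of_nonneg (by linarith), abs_of_nonneg (by linarith)]
    ring

lemma sum_incrementCoeff_covariance {h : ℝ} (hh : 0 ≤ h) (N : ℕ) (w c : ℕ → ℝ)
    (hc : ∀ j, c j = ∑ i ∈ Finset.range N,
      w i * ((if j = i + 1 then 1 else 0) - (if j = i then 1 else 0))) :
    ∑ j ∈ Finset.range (N + 1), ∑ l ∈ Finset.range (N + 1),
      c j * c l * (1 / 2 * (j * h + l * h - |j * h - l * h|)) =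
      h * ∑ i ∈ Finset.range N, w i ^ 2 := by
  have h1 : ∀ j : ℕ, ∑ l ∈ Finset.range (N + 1),
      c j * c l * (1 / 2 * (j * h + l * h - |j * h - l * h|)) =
      c j * ∑ m ∈ Finset.range N, w m *
        (1 / 2 * (j * h + (m + 1 : ℕ) * h - |j * h - (m + 1 : ℕ) * h|) -
          1 / 2 * (j * h + m * h - |j * h - m * h|)) := fun j => by
    rw [← sum_incrementCoeff_mul N w (fun l => 1 / 2 * (j * h + l * h - |j * h - l * h|)),
      Finset.mul_sum]
    exact Finset.sum_congr rfl fun l _ => by rw [hc l]; ring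
  rw [Finset.sum_congr rfl fun j _ => h1 j]
  have h2 := sum_incrementCoeff_mul N w (fun j => ∑ m ∈ Finset.range N, w m *
        (1 / 2 * (j * h + (m + 1 : ℕ) * h - |j * h - (m + 1 : ℕ) * h|) -
          1 / 2 * (j * h + m * h - |j * h - m * h|)))
  simp only [← hc] at h2
  rw [h2, Finset.mul_sum]
  refine Finset.sum_congr rfl fun i hi => ?_
  rw [← Finset.sum_sub_distrib, Finset.sum_congr rfl
    (g := fun m => if i = m then w m * h else 0) fun m _ => by
      rw [← mul_sub, second_difference_covariance hh, mul_ite, mul_zero],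
    Finset.sum_ite_eq, if_pos hi]
  ring

/-! ### The characteristic function of the grey Ornstein-Uhlenbeck process -/

lemma integral_ouKernel_sq (x : ℝ) {t : ℝ} (ht : 0 ≤ t) :
    ∫ s : ℝ, (ouKernel x t s) ^ 2 = ∫ s in (0 : ℝ)..t, Real.exp (-(x * (t - s))) ^ 2 := by
  have e : (fun s => (ouKernel x t s) ^ 2) =
      (Set.Ico 0 t).indicator fun s => Real.exp (-(x * (t - s))) ^ 2 := by
    funext s
    simp only [ouKernel, Set.indicator_apply, neg_mul]
    split_ifs <;> simp
  rw [e, integral_indicator measurableSet_Ico, intervalIntegral.integral_of_le ht,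
    integral_Ico_eq_integral_Ioo, integral_Ioc_eq_integral_Ioo]

/-- The lower Riemann sums of `∫ ouKernel²` over the uniform partitions converge. -/
lemma tendsto_riemannSum_ouKernel_sq {x t : ℝ} (hx : 0 ≤ x) (ht : 0 < t) :
    Filter.Tendsto (fun n : ℕ => t / ((n : ℝ) + 1) * ∑ i ∈ Finset.range (n + 1),
      Real.exp (-(x * (t - i * (t / (n + 1))))) ^ 2) Filter.atTop
      (nhds (∫ s : ℝ, (ouKernel x t s) ^ 2)) := by
  rw [integral_ouKernel_sq x ht.le]
  set I := ∫ s in (0 : ℝ)..t, Real.exp (-(x * (t - s))) ^ 2 with hI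
  have hint : ∀ a b : ℝ, IntervalIntegrable (fun s => Real.exp (-(x * (t - s))) ^ 2) volume a b :=
    fun a b => Continuous.intervalIntegrable (by fun_prop) a b
  -- on a cell of length `h` the integrand varies by a factor of at most `e^{2xh}`
  have hbounds : ∀ n : ℕ, Real.exp (-(2 * x * (t / ((n : ℝ) + 1)))) * I ≤
      t / ((n : ℝ) + 1) * ∑ i ∈ Finset.range (n + 1),
        Real.exp (-(x * (t - i * (t / (n + 1))))) ^ 2 ∧
      t / ((n : ℝ) + 1) * ∑ i ∈ Finset.range (n + 1),
        Real.exp (-(x * (t - i * (t / (n + 1))))) ^ 2 ≤ I := by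
    intro n
    set h : ℝ := t / ((n : ℝ) + 1) with hh
    have hh0 : 0 < h := by positivity
    have hnh : ((n + 1 : ℕ) : ℝ) * h = t := by
      rw [hh]; push_cast; field_simp
    have hsum := intervalIntegral.sum_integral_adjacent_intervals (n := n + 1)
      (a := fun i : ℕ => (i : ℝ) * h) (f := fun s => Real.exp (-(x * (t - s))) ^ 2) (μ := volume)
      fun k _ => hint _ _
    simp only [Nat.cast_zero, zero_mul, hnh] at hsum
    have hlen : ∀ i : ℕ, ((i + 1 : ℕ) : ℝ) * h - i * h = h := fun i => by push_cast; ring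
    have hconst : ∀ (i : ℕ) (c : ℝ), ∫ _ in (i * h)..((i + 1 : ℕ) * h), c = h * c := fun i c => by
      rw [intervalIntegral.integral_const, hlen, smul_eq_mul]
    have hleab : ∀ i : ℕ, (i : ℝ) * h ≤ (i + 1 : ℕ) * h := fun i => by linarith [hlen i]
    rw [hI, ← hsum, Finset.mul_sum, Finset.mul_sum]
    constructor
    · refine Finset.sum_le_sum fun i _ => ?_
      rw [← hconst, ← intervalIntegral.integral_const_mul]
      refine intervalIntegral.integral_mono_on (hleab i) ((hint _ _).const_mul _)
        intervalIntegrable_const fun s hs => ?_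
      rw [← Real.exp_nat_mul, ← Real.exp_nat_mul, ← Real.exp_add]
      refine Real.exp_le_exp.mpr ?_
      have h1 := hs.2
      have h2 := mul_le_mul_of_nonneg_left (show s - i * h ≤ h by linarith [hlen i]) hx
      push_cast
      linarith
    · refine Finset.sum_le_sum fun i _ => ?_
      rw [← hconst]
      refine intervalIntegral.integral_mono_on (hleab i) intervalIntegrable_const
        (hint _ _) fun s hs => ?_
      have h1 : x * (t - s) ≤ x * (t - i * h) :=
        mul_le_mul_of_nonneg_left (by linarith [hs.1]) hx
      gcongr
  have hlim : Filter.Tendsto (fun n : ℕ => Real.exp (-(2 * x * (t / ((n : ℝ) + 1)))) * I)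
      Filter.atTop (nhds I) := by
    have h0 : Filter.Tendsto (fun n : ℕ => -(2 * x * (t / ((n : ℝ) + 1)))) Filter.atTop
        (nhds 0) := by
      have := (tendsto_one_div_add_atTop_nhds_zero_nat (𝕜 := ℝ)).const_mul (-(2 * x * t))
      rw [mul_zero] at this
      refine this.congr fun n => ?_
      ring
    have := ((Real.continuous_exp.tendsto 0).comp h0).mul_const I
    simpa using this
  exact tendsto_of_tendsto_of_tendsto_of_le_of_le hlim tendsto_const_nhds
    (fun n => (hbounds n).1) (fun n => (hbounds n).2)

section GreyBrownianMotion

variable {Ω : Type*} [MeasurableSpace Ω] {P : Measure Ω} {d : ℕ} {β : ℝ}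
  {B : ℝ → Ω → EuclideanSpace ℝ (Fin d)}

/-- The characteristic function of a weighted sum of increments of grey Brownian motion over a
uniform partition. -/
lemma IsGeneralizedGreyBM.char_fun_increments (hB : IsGeneralizedGreyBM P β 1 B) {h : ℝ}
    (hh : 0 < h) (N : ℕ) (w : ℕ → ℝ) (k : EuclideanSpace ℝ (Fin d)) :
    ∫ ω, Complex.exp (Complex.I * ((inner ℝ k (∑ i ∈ Finset.range N,
      w i • (B ((i + 1 : ℕ) * h) ω - B (i * h) ω)) : ℝ) : ℂ)) ∂P =
      mittagLeffler β
        ((-(‖k‖ ^ 2 / 2 * (h * ∑ i ∈ Finset.range N, w i ^ 2)) : ℝ) : ℂ) := by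
  set c : ℕ → ℝ := fun j => ∑ i ∈ Finset.range N,
    w i * ((if j = i + 1 then 1 else 0) - (if j = i then 1 else 0)) with hc
  have key := hB.char_fun (N + 1) (fun j => (j : ℕ) * h) (fun j => c j • k)
    (fun j => by positivity) (fun i j hij => by
      have : (i : ℕ) < (j : ℕ) := hij
      have : ((i : ℕ) : ℝ) < (j : ℕ) := by exact_mod_cast this
      simp only
      gcongr)
  have hlin : ∀ ω, ∑ j : Fin (N + 1), inner ℝ (c j • k) (B ((j : ℕ) * h) ω) =
      inner ℝ k (∑ i ∈ Finset.range N, w i • (B ((i + 1 : ℕ) * h) ω - B (i * h) ω)) := by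
    intro ω
    simp only [real_inner_smul_left, inner_sum, real_inner_smul_right, inner_sub_right]
    rw [Fin.sum_univ_eq_sum_range (fun j : ℕ => c j * inner ℝ k (B (j * h) ω)) (N + 1)]
    exact sum_incrementCoeff_mul N w (fun j : ℕ => inner ℝ k (B (j * h) ω))
  simp only [hlin] at key
  rw [key]
  refine congrArg (fun q : ℝ => mittagLeffler β (q : ℂ)) ?_
  simp only [Real.rpow_one, real_inner_smul_left, real_inner_smul_right, real_inner_self_eq_norm_sq]
  have e : ∀ j l : Fin (N + 1), 1 / 2 * ((j : ℕ) * h + (l : ℕ) * h - |(j : ℕ) * h - (l : ℕ) * h|) *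
      (c l * (c j * ‖k‖ ^ 2)) = ‖k‖ ^ 2 * (c j * c l *
        (1 / 2 * ((j : ℕ) * h + (l : ℕ) * h - |(j : ℕ) * h - (l : ℕ) * h|))) := fun j l => by ring
  simp only [e, ← Finset.mul_sum]
  have h2 : ∀ j : ℕ, ∑ l : Fin (N + 1), c j * c l *
      (1 / 2 * (j * h + (l : ℕ) * h - |j * h - (l : ℕ) * h|)) =
      ∑ l ∈ Finset.range (N + 1), c j * c l * (1 / 2 * (j * h + l * h - |j * h - l * h|)) :=
    fun j => Fin.sum_univ_eq_sum_range (fun l : ℕ => c j * c l *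
      (1 / 2 * (j * h + l * h - |j * h - l * h|))) (N + 1)
  simp only [h2]
  rw [Fin.sum_univ_eq_sum_range (fun j : ℕ => ∑ l ∈ Finset.range (N + 1), c j * c l *
      (1 / 2 * (j * h + l * h - |j * h - l * h|))) (N + 1),
    sum_incrementCoeff_covariance hh.le N w c fun j => rfl]
  ring

lemma mittagLeffler_zero (hβ0 : 0 < β) (hβ1 : β < 1) : mittagLeffler β 0 = 1 := by
  have := mittagLeffler_neg_eq_laplace hβ0 hβ1 0
  simpa [integral_mWright hβ0 hβ1] using this

lemma charFun_greyOrnsteinUhlenbeck [IsProbabilityMeasure P] {x : ℝ}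
    {Z : ℝ → Ω → EuclideanSpace ℝ (Fin d)} (hβ0 : 0 < β) (hβ1 : β < 1) (hx : 0 ≤ x)
    (hB : IsGeneralizedGreyBM P β 1 B) (hZ : IsOrnsteinUhlenbeckSolution P x B Z) {t : ℝ}
    (ht : 0 ≤ t) (k : EuclideanSpace ℝ (Fin d)) :
    ∫ ω, Complex.exp (Complex.I * ((inner ℝ k (Z t ω) : ℝ) : ℂ)) ∂P =
      mittagLeffler β ((-(‖k‖ ^ 2 / 2 * ∫ s : ℝ, (ouKernel x t s) ^ 2) : ℝ) : ℂ) := by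
  rcases ht.eq_or_lt with rfl | ht0
  · have h1 : ∫ ω, Complex.exp (Complex.I * ((inner ℝ k (Z 0 ω) : ℝ) : ℂ)) ∂P = 1 := by
      rw [integral_congr_ae (g := fun _ => (1 : ℂ))]
      · simp
      · filter_upwards [hZ.start_zero] with ω hω
        simp [hω]
    rw [h1, integral_ouKernel_sq x le_rfl]
    simp [mittagLeffler_zero hβ0 hβ1]
  · set D : ℕ → Ω → EuclideanSpace ℝ (Fin d) := fun n ω => ∑ i ∈ Finset.range (n + 1),
      Real.exp (-(x * (t - i * (t / (n + 1))))) • (B ((i + 1 : ℕ) * (t / (n + 1))) ω -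
        B (i * (t / (n + 1))) ω) with hD
    have hDmeas : ∀ n, Measurable (D n) := fun n =>
      Finset.measurable_fun_sum _ fun i _ => by
        have h1 := hB.measurable ((i + 1 : ℕ) * (t / (n + 1))) (by positivity)
        have h2 := hB.measurable (i * (t / (n + 1))) (by positivity)
        fun_prop
    have hlim : ∀ᵐ ω ∂P, Filter.Tendsto (fun n => D n ω) Filter.atTop (nhds (Z t ω)) := by
      filter_upwards [hZ.continuous_paths, hZ.start_zero, hZ.equation] with ω h1 h2 h3
      exact tendsto_sum_exp_smul_sub (z := fun s => Z s ω) (b := fun s => B s ω) hx ht0 h1 h2 h3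
    have hL : Filter.Tendsto (fun n => ∫ ω, Complex.exp (Complex.I *
        ((inner ℝ k (D n ω) : ℝ) : ℂ)) ∂P) Filter.atTop
        (nhds (∫ ω, Complex.exp (Complex.I * ((inner ℝ k (Z t ω) : ℝ) : ℂ)) ∂P)) := by
      refine tendsto_integral_of_dominated_convergence (fun _ => 1) (fun n => ?_)
        (integrable_const _) (fun n => Filter.Eventually.of_forall fun ω => ?_) ?_
      · have := hDmeas n
        exact Measurable.aestronglyMeasurable (by fun_prop)
      · rw [mul_comm, Complex.norm_exp_ofReal_mul_I]
      · filter_upwards [hlim] with ω hω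
        have hcont : Continuous fun v : EuclideanSpace ℝ (Fin d) =>
          Complex.exp (Complex.I * ((inner ℝ k v : ℝ) : ℂ)) := by fun_prop
        exact (hcont.tendsto _).comp hω
    have hR : Filter.Tendsto (fun n : ℕ => mittagLeffler β ((-(‖k‖ ^ 2 / 2 *
        (t / ((n : ℝ) + 1) * ∑ i ∈ Finset.range (n + 1),
          Real.exp (-(x * (t - i * (t / (n + 1))))) ^ 2)) : ℝ) : ℂ)) Filter.atTop
        (nhds (mittagLeffler β ((-(‖k‖ ^ 2 / 2 * ∫ s : ℝ, (ouKernel x t s) ^ 2) : ℝ) : ℂ))) := by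
      have h1 := (tendsto_riemannSum_ouKernel_sq hx ht0).const_mul (‖k‖ ^ 2 / 2)
      have hnn : 0 ≤ ‖k‖ ^ 2 / 2 * ∫ s : ℝ, (ouKernel x t s) ^ 2 :=
        mul_nonneg (by positivity) (integral_nonneg fun s => sq_nonneg _)
      have h2 := (continuousOn_mittagLeffler_neg hβ0 hβ1) _ hnn
      refine h2.tendsto.comp (tendsto_nhdsWithin_iff.mpr ⟨h1, Filter.Eventually.of_forall
        fun n => ?_⟩)
      have : (0 : ℝ) ≤ ∑ i ∈ Finset.range (n + 1),
        Real.exp (-(x * (t - i * (t / (n + 1))))) ^ 2 := Finset.sum_nonneg fun i _ => sq_nonneg _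
      have h4 : 0 ≤ t / ((n : ℝ) + 1) := by positivity
      exact mul_nonneg (by positivity) (mul_nonneg h4 this)
    refine tendsto_nhds_unique (hL.congr fun n => ?_) hR
    exact hB.char_fun_increments (h := t / ((n : ℝ) + 1)) (by positivity) (n + 1)
      (fun i => Real.exp (-(x * (t - i * (t / (n + 1)))))) k

end GreyBrownianMotion

/-! ### The density -/

section Density

variable {d : ℕ} {β : ℝ}

lemma mWrightIntegrand_nonneg (hβ0 : 0 < β) (hβ1 : β < 1) (y : EuclideanSpace ℝ (Fin d)) {t τ : ℝ}
    (ht : 0 < t) (hτ : 0 < τ) : 0 ≤ mWrightIntegrand β y t τ := by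
  have h := mWright_nonneg hβ0 hβ1 (mul_pos hτ (Real.rpow_pos_of_pos ht (-β)))
  rw [mWrightIntegrand]
  positivity

lemma mWrightHalf_nonneg (hβ0 : 0 < β) (hβ1 : β < 1) (y : EuclideanSpace ℝ (Fin d)) {t : ℝ}
    (ht : 0 < t) : 0 ≤ mWrightHalf β y t :=
  mul_nonneg zero_le_two (setIntegral_nonneg measurableSet_Ioi fun _ hτ =>
    mWrightIntegrand_nonneg hβ0 hβ1 y ht hτ)

lemma integrableOn_mul_mWright_mul (hβ0 : 0 < β) (hβ1 : β < 1) {c : ℝ} (hc : 0 < c) :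
    IntegrableOn (fun τ => c * mWright β (τ * c)) (Set.Ioi 0) := by
  have h : IntegrableOn (fun τ => mWright β (τ * c)) (Set.Ioi 0) := by
    rw [integrableOn_Ioi_comp_mul_right_iff (mWright β) 0 hc, zero_mul]
    exact integrableOn_mWright hβ0 hβ1
  exact h.const_mul c

/-- Off the origin the heat kernel is bounded in time. -/
lemma exists_heatKernel_le (d : ℕ) {A : ℝ} (hA : 0 < A) :
    ∃ C, ∀ τ : ℝ, 0 < τ →
      Real.exp (-(A / (4 * τ))) / (4 * Real.pi * τ) ^ ((d : ℝ) / 2) ≤ C := by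
  have hpi := Real.pi_pos
  refine ⟨d.factorial * Real.exp 1 / (Real.pi * A) ^ ((d : ℝ) / 2), fun τ hτ => ?_⟩
  set w : ℝ := A / (4 * τ) with hw
  have hw0 : 0 < w := by positivity
  have e : 4 * Real.pi * τ = Real.pi * A / w := by
    rw [hw]; field_simp
  have h1 : w ^ ((d : ℝ) / 2) ≤ (1 + w) ^ d := by
    calc w ^ ((d : ℝ) / 2) ≤ (1 + w) ^ ((d : ℝ) / 2) :=
          Real.rpow_le_rpow hw0.le (by linarith) (by positivity)
      _ ≤ (1 + w) ^ (d : ℝ) := Real.rpow_le_rpow_of_exponent_le (by linarith)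
          (by linarith [Nat.cast_nonneg (α := ℝ) d])
      _ = (1 + w) ^ d := Real.rpow_natCast _ _
  have h2 : (1 + w) ^ d ≤ d.factorial * Real.exp (1 + w) := by
    have := Real.pow_div_factorial_le_exp (1 + w) (by positivity) d
    rwa [div_le_iff₀' (by positivity)] at this
  rw [e, Real.div_rpow (by positivity) hw0.le, div_div_eq_mul_div]
  refine div_le_div_of_nonneg_right ?_ (by positivity)
  calc Real.exp (-w) * w ^ ((d : ℝ) / 2) ≤ Real.exp (-w) * (d.factorial * Real.exp (1 + w)) := by
        gcongr
        exact h1.trans h2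
    _ = d.factorial * Real.exp 1 := by
        rw [mul_left_comm, ← Real.exp_add]
        ring_nf

lemma integrableOn_mWrightIntegrand (hβ0 : 0 < β) (hβ1 : β < 1) {y : EuclideanSpace ℝ (Fin d)}
    (hy : y ≠ 0) {t : ℝ} (ht : 0 < t) :
    IntegrableOn (mWrightIntegrand β y t) (Set.Ioi 0) := by
  obtain ⟨C, hC⟩ := exists_heatKernel_le d (A := ‖y‖ ^ 2) (by positivity)
  refine (integrableOn_mul_mWright_mul hβ0 hβ1 (Real.rpow_pos_of_pos ht (-β))).bdd_mul (c := C)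
    (Measurable.aestronglyMeasurable (by fun_prop)) ?_
  filter_upwards [ae_restrict_mem measurableSet_Ioi] with τ hτ
  have hτ0 : (0 : ℝ) < τ := hτ
  have := Real.pi_pos
  rw [Real.norm_of_nonneg (by positivity)]
  exact hC τ hτ

lemma norm_sqrt_two_smul_sq (y : EuclideanSpace ℝ (Fin d)) :
    ‖Real.sqrt 2 • y‖ ^ 2 = 2 * ‖y‖ ^ 2 := by
  rw [norm_smul, mul_pow, Real.norm_of_nonneg (Real.sqrt_nonneg 2), Real.sq_sqrt zero_le_two]

/-- The Fourier transform of the heat kernel `y ↦ (4πτ)^{-d/2} e^{-|√2 y|²/(4τ)}`. -/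
lemma integral_cexp_mul_heatKernel (k : EuclideanSpace ℝ (Fin d)) {τ : ℝ} (hτ : 0 < τ) :
    ∫ y : EuclideanSpace ℝ (Fin d), Complex.exp ((inner ℝ y k : ℝ) * Complex.I) *
      ((Real.exp (-(‖Real.sqrt 2 • y‖ ^ 2 / (4 * τ))) /
        (4 * Real.pi * τ) ^ ((d : ℝ) / 2) : ℝ) : ℂ) =
      ((2 ^ (-((d : ℝ) / 2)) * Real.exp (-(‖k‖ ^ 2 / 2 * τ)) : ℝ) : ℂ) := by
  have hpi := Real.pi_pos
  have hb : 0 < (((1 / (2 * τ) : ℝ)) : ℂ).re := by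
    rw [Complex.ofReal_re]
    positivity
  have h := GaussianFourier.integral_cexp_neg_mul_sq_norm_add hb Complex.I k
  have e1 : ∀ y : EuclideanSpace ℝ (Fin d), Complex.exp ((inner ℝ y k : ℝ) * Complex.I) *
      ((Real.exp (-(‖Real.sqrt 2 • y‖ ^ 2 / (4 * τ))) /
        (4 * Real.pi * τ) ^ ((d : ℝ) / 2) : ℝ) : ℂ) =
      Complex.exp (-((1 / (2 * τ) : ℝ) : ℂ) * (‖y‖ : ℂ) ^ 2 + Complex.I * (inner ℝ k y : ℝ)) *
        (((4 * Real.pi * τ) ^ (-((d : ℝ) / 2)) : ℝ) : ℂ) := fun y => by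
    rw [norm_sqrt_two_smul_sq, div_eq_mul_inv (Real.exp _), ← Real.rpow_neg (by positivity),
      Complex.ofReal_mul, ← mul_assoc, Complex.ofReal_exp, ← Complex.exp_add, real_inner_comm y k]
    congr 2
    push_cast
    field_simp
    ring
  have e2 : ((Real.pi : ℂ) / ((1 / (2 * τ) : ℝ) : ℂ)) ^
      (((Module.finrank ℝ (EuclideanSpace ℝ (Fin d)) : ℕ) : ℂ) / 2) =
      (((2 * Real.pi * τ) ^ ((d : ℝ) / 2) : ℝ) : ℂ) := by
    rw [finrank_euclideanSpace_fin, Complex.ofReal_cpow (by positivity)]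
    congr 1
    · push_cast
      field_simp
    · push_cast
      rfl
  have e3 : Complex.exp (Complex.I ^ 2 * (‖k‖ : ℂ) ^ 2 / (4 * ((1 / (2 * τ) : ℝ) : ℂ))) =
      ((Real.exp (-(‖k‖ ^ 2 / 2 * τ)) : ℝ) : ℂ) := by
    rw [Complex.I_sq, Complex.ofReal_exp]
    congr 1
    push_cast
    have : (τ : ℂ) ≠ 0 := Complex.ofReal_ne_zero.mpr hτ.ne'
    field_simp
    ring
  rw [integral_congr_ae (Filter.Eventually.of_forall e1), integral_mul_const, h, e2, e3,
    ← Complex.ofReal_mul, ← Complex.ofReal_mul]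
  congr 1
  have e4 : (2 * Real.pi * τ) ^ ((d : ℝ) / 2) * (4 * Real.pi * τ) ^ (-((d : ℝ) / 2)) =
      2 ^ (-((d : ℝ) / 2)) := by
    rw [show 4 * Real.pi * τ = 2 * (2 * Real.pi * τ) by ring,
      Real.mul_rpow (x := 2) (y := 2 * Real.pi * τ) (by norm_num) (by positivity), mul_left_comm,
      ← Real.rpow_add (by positivity), add_neg_cancel,
      Real.rpow_zero, mul_one]
  rw [← e4]
  ring

lemma integrable_heatKernel {τ : ℝ} (hτ : 0 < τ) :
    Integrable fun y : EuclideanSpace ℝ (Fin d) =>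
      Real.exp (-(‖Real.sqrt 2 • y‖ ^ 2 / (4 * τ))) / (4 * Real.pi * τ) ^ ((d : ℝ) / 2) := by
  have hb : 0 < (((1 / (2 * τ) : ℝ)) : ℂ).re := by
    rw [Complex.ofReal_re]
    positivity
  have h := (GaussianFourier.integrable_cexp_neg_mul_sq_norm_add hb 0
    (0 : EuclideanSpace ℝ (Fin d))).norm.div_const ((4 * Real.pi * τ) ^ ((d : ℝ) / 2))
  refine h.congr (Filter.Eventually.of_forall fun y => ?_)
  simp only
  rw [norm_sqrt_two_smul_sq, zero_mul, add_zero, ← Complex.ofReal_pow, ← Complex.ofReal_neg,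
    ← Complex.ofReal_mul, ← Complex.ofReal_exp, Complex.norm_real,
    Real.norm_of_nonneg (Real.exp_pos _).le]
  congr 2
  field_simp
  ring

lemma integral_heatKernel {τ : ℝ} (hτ : 0 < τ) :
    ∫ y : EuclideanSpace ℝ (Fin d),
      Real.exp (-(‖Real.sqrt 2 • y‖ ^ 2 / (4 * τ))) / (4 * Real.pi * τ) ^ ((d : ℝ) / 2) =
      2 ^ (-((d : ℝ) / 2)) := by
  have h := integral_cexp_mul_heatKernel (0 : EuclideanSpace ℝ (Fin d)) hτ
  simp only [inner_zero_right, Complex.ofReal_zero, zero_mul, Complex.exp_zero, one_mul] at h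
  rw [integral_complex_ofReal] at h
  have := Complex.ofReal_injective h
  simpa using this

lemma integrable_prod_mWrightIntegrand (hβ0 : 0 < β) (hβ1 : β < 1) {t : ℝ} (ht : 0 < t) :
    Integrable (fun p : EuclideanSpace ℝ (Fin d) × ℝ =>
      mWrightIntegrand β (Real.sqrt 2 • p.1) t p.2)
      (volume.prod (volume.restrict (Set.Ioi (0 : ℝ)))) := by
  have hc := integrableOn_mul_mWright_mul hβ0 hβ1 (Real.rpow_pos_of_pos ht (-β))
  have hmeas : AEStronglyMeasurable (fun p : EuclideanSpace ℝ (Fin d) × ℝ =>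
      mWrightIntegrand β (Real.sqrt 2 • p.1) t p.2)
      (volume.prod (volume.restrict (Set.Ioi (0 : ℝ)))) :=
    AEStronglyMeasurable.mul (Measurable.aestronglyMeasurable (by fun_prop))
      hc.aestronglyMeasurable.comp_snd
  refine (integrable_prod_iff' hmeas).mpr ⟨?_, ?_⟩
  · filter_upwards [ae_restrict_mem measurableSet_Ioi] with τ hτ
    exact (integrable_heatKernel hτ).mul_const _
  · refine (hc.const_mul (2 ^ (-((d : ℝ) / 2)))).congr ?_
    filter_upwards [ae_restrict_mem measurableSet_Ioi] with τ hτ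
    rw [integral_congr_ae (Filter.Eventually.of_forall fun y =>
      Real.norm_of_nonneg (mWrightIntegrand_nonneg hβ0 hβ1 (Real.sqrt 2 • y) ht hτ))]
    simp only [mWrightIntegrand]
    rw [integral_mul_const, integral_heatKernel hτ]

/-- Fubini gives the integrability without a discussion of `y = 0`, where for `d ≥ 2` the defining
integral diverges and `mWrightHalf` is `0` by convention. -/
lemma integrable_mWrightHalf (hβ0 : 0 < β) (hβ1 : β < 1) {t : ℝ} (ht : 0 < t) :
    Integrable fun y : EuclideanSpace ℝ (Fin d) => 1 / 2 * (2 : ℝ) ^ ((d : ℝ) / 2) *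
      mWrightHalf β (Real.sqrt 2 • y) t :=
  ((integrable_prod_mWrightIntegrand hβ0 hβ1 ht).integral_prod_left.const_mul 2).const_mul _

/-- The Fourier transform of the density. By Fubini it is the mixture, with mixing density `M_β`, of
the Fourier transforms of centered Gaussians, that is, a Laplace transform of `M_β`. -/
lemma integral_cexp_mul_mWrightHalf (hβ0 : 0 < β) (hβ1 : β < 1) {t : ℝ} (ht : 0 < t)
    (k : EuclideanSpace ℝ (Fin d)) :
    ∫ y : EuclideanSpace ℝ (Fin d), Complex.exp ((inner ℝ y k : ℝ) * Complex.I) *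
      ((1 / 2 * (2 : ℝ) ^ ((d : ℝ) / 2) * mWrightHalf β (Real.sqrt 2 • y) t : ℝ) : ℂ) =
      mittagLeffler β ((-(‖k‖ ^ 2 / 2 * t ^ β) : ℝ) : ℂ) := by
  have hc : 0 < t ^ (-β) := Real.rpow_pos_of_pos ht _
  have hint : Integrable (fun p : EuclideanSpace ℝ (Fin d) × ℝ =>
      Complex.exp ((inner ℝ p.1 k : ℝ) * Complex.I) *
        ((mWrightIntegrand β (Real.sqrt 2 • p.1) t p.2 : ℝ) : ℂ))
      (volume.prod (volume.restrict (Set.Ioi (0 : ℝ)))) := by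
    refine (integrable_prod_mWrightIntegrand hβ0 hβ1 ht).ofReal.bdd_mul (c := 1)
      (Measurable.aestronglyMeasurable (by fun_prop)) (Filter.Eventually.of_forall fun p => ?_)
    rw [Complex.norm_exp_ofReal_mul_I]
  have hswap := integral_integral_swap (f := fun (y : EuclideanSpace ℝ (Fin d)) (τ : ℝ) =>
      Complex.exp ((inner ℝ y k : ℝ) * Complex.I) *
        ((mWrightIntegrand β (Real.sqrt 2 • y) t τ : ℝ) : ℂ)) hint
  have hinner : ∀ τ ∈ Set.Ioi (0 : ℝ), ∫ y : EuclideanSpace ℝ (Fin d),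
      Complex.exp ((inner ℝ y k : ℝ) * Complex.I) *
        ((mWrightIntegrand β (Real.sqrt 2 • y) t τ : ℝ) : ℂ) =
      ((2 ^ (-((d : ℝ) / 2)) * (Real.exp (-(‖k‖ ^ 2 / 2 * τ)) *
        (t ^ (-β) * mWright β (τ * t ^ (-β)))) : ℝ) : ℂ) := fun τ hτ => by
    have e : ∀ y : EuclideanSpace ℝ (Fin d), Complex.exp ((inner ℝ y k : ℝ) * Complex.I) *
        ((mWrightIntegrand β (Real.sqrt 2 • y) t τ : ℝ) : ℂ) =
        Complex.exp ((inner ℝ y k : ℝ) * Complex.I) *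
        ((Real.exp (-(‖Real.sqrt 2 • y‖ ^ 2 / (4 * τ))) /
          (4 * Real.pi * τ) ^ ((d : ℝ) / 2) : ℝ) : ℂ) *
          ((t ^ (-β) * mWright β (τ * t ^ (-β)) : ℝ) : ℂ) := fun y => by
      rw [mWrightIntegrand, Complex.ofReal_mul]
      exact (mul_assoc _ _ _).symm
    rw [integral_congr_ae (Filter.Eventually.of_forall e), integral_mul_const,
      integral_cexp_mul_heatKernel k hτ, ← Complex.ofReal_mul, mul_assoc]
  have hpow : (2 : ℝ) ^ ((d : ℝ) / 2) * 2 ^ (-((d : ℝ) / 2)) = 1 := by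
    rw [← Real.rpow_add two_pos, add_neg_cancel, Real.rpow_zero]
  have hscale : ∫ τ in Set.Ioi (0 : ℝ), Real.exp (-(‖k‖ ^ 2 / 2 * τ)) *
      (t ^ (-β) * mWright β (τ * t ^ (-β))) =
      ∫ r in Set.Ioi (0 : ℝ), Real.exp (-(‖k‖ ^ 2 / 2 * t ^ β * r)) * mWright β r := by
    have h := integral_comp_mul_right_Ioi
      (fun r => Real.exp (-(‖k‖ ^ 2 / 2 * t ^ β * r)) * mWright β r) 0 hc
    rw [zero_mul, smul_eq_mul, eq_inv_mul_iff_mul_eq₀ hc.ne', ← integral_const_mul] at h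
    rw [← h]
    refine setIntegral_congr_fun measurableSet_Ioi fun τ _ => ?_
    have e : ‖k‖ ^ 2 / 2 * t ^ β * (τ * t ^ (-β)) = ‖k‖ ^ 2 / 2 * τ := by
      have : t ^ β * t ^ (-β) = 1 := by rw [← Real.rpow_add ht, add_neg_cancel, Real.rpow_zero]
      linear_combination (‖k‖ ^ 2 / 2 * τ) * this
    simp only [e]
    ring
  calc ∫ y : EuclideanSpace ℝ (Fin d), Complex.exp ((inner ℝ y k : ℝ) * Complex.I) *
      ((1 / 2 * (2 : ℝ) ^ ((d : ℝ) / 2) * mWrightHalf β (Real.sqrt 2 • y) t : ℝ) : ℂ)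
      = ∫ y : EuclideanSpace ℝ (Fin d), (((2 : ℝ) ^ ((d : ℝ) / 2) : ℝ) : ℂ) *
        ∫ τ in Set.Ioi (0 : ℝ), Complex.exp ((inner ℝ y k : ℝ) * Complex.I) *
          ((mWrightIntegrand β (Real.sqrt 2 • y) t τ : ℝ) : ℂ) := by
        refine integral_congr_ae (Filter.Eventually.of_forall fun y => ?_)
        simp only
        rw [integral_const_mul, integral_complex_ofReal, mWrightHalf]
        push_cast
        ring
    _ = (((2 : ℝ) ^ ((d : ℝ) / 2) : ℝ) : ℂ) * ((2 ^ (-((d : ℝ) / 2)) *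
        ∫ τ in Set.Ioi (0 : ℝ), Real.exp (-(‖k‖ ^ 2 / 2 * τ)) *
        (t ^ (-β) * mWright β (τ * t ^ (-β))) : ℝ) : ℂ) := by
        rw [integral_const_mul, hswap, setIntegral_congr_fun measurableSet_Ioi hinner,
          integral_complex_ofReal, integral_const_mul]
    _ = _ := by
        rw [← Complex.ofReal_mul, ← mul_assoc, hpow, one_mul, hscale,
          mittagLeffler_neg_eq_laplace hβ0 hβ1]

end Density

lemma integral_ouKernel_sq_eq {x t : ℝ} (hx : 0 < x) (ht : 0 ≤ t) :
    ∫ s : ℝ, (ouKernel x t s) ^ 2 = 1 / (2 * x) * (1 - Real.exp (-2 * x * t)) := by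
  rw [integral_ouKernel_sq x ht, intervalIntegral.integral_eq_sub_of_hasDerivAt
    (f := fun s => Real.exp (-(x * (t - s))) ^ 2 / (2 * x))]
  · simp only [← Real.exp_nat_mul]
    rw [sub_self, mul_zero, neg_zero, mul_zero, Real.exp_zero]
    push_cast
    ring_nf
  · intro s _
    have h : HasDerivAt (fun s => -(x * (t - s))) x s :=
      (((hasDerivAt_id s).const_sub t).const_mul x).neg.congr_deriv (by simp)
    refine ((h.exp.pow 2).div_const (2 * x)).congr_deriv ?_
    field_simp
    ring
  · exact Continuous.intervalIntegrable (by fun_prop) _ _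

theorem proposition3p4 {Ω : Type*} [MeasurableSpace Ω] (P : Measure Ω) [IsProbabilityMeasure P]
    (d : ℕ) (β x : ℝ) (hβ0 : 0 < β) (hβ1 : β < 1) (hx : 0 ≤ x)
    (B Z : ℝ → Ω → EuclideanSpace ℝ (Fin d))
    (hB : IsGeneralizedGreyBM P β 1 B) (hZ : IsOrnsteinUhlenbeckSolution P x B Z) :
    -- characteristic function
    (∀ (t : ℝ) (k : EuclideanSpace ℝ (Fin d)), 0 ≤ t →
      ∫ ω, Complex.exp (Complex.I * ((inner ℝ k (Z t ω) : ℝ) : ℂ)) ∂P =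
        mittagLeffler β ((-(‖k‖ ^ 2 / 2) * ∫ s : ℝ, (ouKernel x t s) ^ 2 : ℝ) : ℂ)) ∧
    -- density with respect to Lebesgue measure
    (0 < x → ∀ (t : ℝ) (ρ : EuclideanSpace ℝ (Fin d) → ℝ), 0 < t →
      (∀ y, ρ y = 1 / 2 * (2 : ℝ) ^ ((d : ℝ) / 2) *
        mWrightHalf β (Real.sqrt 2 • y)
          ((1 / (2 * x) * (1 - Real.exp (-2 * x * t))) ^ (1 / β))) →
      (∀ y, y ≠ 0 →
        IntegrableOn (mWrightIntegrand β (Real.sqrt 2 • y)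
          ((1 / (2 * x) * (1 - Real.exp (-2 * x * t))) ^ (1 / β))) (Set.Ioi 0) ∧
        0 ≤ ρ y) ∧
      P.map (Z t) = volume.withDensity (fun y => ENNReal.ofReal (ρ y))) := by
  refine ⟨fun t k ht => ?_, fun hx0 t ρ ht hρ => ?_⟩
  · rw [neg_mul]
    exact charFun_greyOrnsteinUhlenbeck hβ0 hβ1 hx hB hZ ht k
  have hσ : 0 < 1 / (2 * x) * (1 - Real.exp (-2 * x * t)) := by
    have : Real.exp (-2 * x * t) < 1 := Real.exp_lt_one_iff.mpr (by nlinarith)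
    have h1 : 0 < 1 - Real.exp (-2 * x * t) := by linarith
    positivity
  set σ : ℝ := 1 / (2 * x) * (1 - Real.exp (-2 * x * t)) with hσdef
  have hT : 0 < σ ^ (1 / β) := Real.rpow_pos_of_pos hσ _
  have hTβ : (σ ^ (1 / β)) ^ β = σ := by
    rw [← Real.rpow_mul hσ.le, one_div, inv_mul_cancel₀ hβ0.ne', Real.rpow_one]
  have hρ0 : ∀ y, 0 ≤ ρ y := fun y => by
    have := mWrightHalf_nonneg hβ0 hβ1 (Real.sqrt 2 • y) hT
    rw [hρ y]
    positivity
  refine ⟨fun y hy => ⟨integrableOn_mWrightIntegrand hβ0 hβ1 ?_ hT, hρ0 y⟩, ?_⟩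
  · exact smul_ne_zero (by positivity) hy
  have hρint : Integrable ρ := by
    rw [funext hρ]
    exact integrable_mWrightHalf hβ0 hβ1 hT
  have hZm : AEMeasurable (Z t) P := (hZ.measurable t ht.le).aemeasurable
  have : IsFiniteMeasure (volume.withDensity fun y => ENNReal.ofReal (ρ y)) :=
    isFiniteMeasure_withDensity_ofReal hρint.2
  refine Measure.ext_of_charFun (funext fun k => ?_)
  rw [charFun_apply, charFun_apply, integral_map hZm
    (Measurable.aestronglyMeasurable (by fun_prop)),
    integral_withDensity_eq_integral_toReal_smul₀ hρint.aemeasurable.ennreal_ofReal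
      (Filter.Eventually.of_forall fun y => ENNReal.ofReal_lt_top)]
  have h1 := charFun_greyOrnsteinUhlenbeck hβ0 hβ1 hx hB hZ ht.le k
  have h2 := integral_cexp_mul_mWrightHalf hβ0 hβ1 hT k
  rw [integral_ouKernel_sq_eq hx0 ht.le, ← hσdef] at h1
  rw [hTβ] at h2
  calc ∫ ω, Complex.exp ((inner ℝ (Z t ω) k : ℝ) * Complex.I) ∂P
      = ∫ ω, Complex.exp (Complex.I * ((inner ℝ k (Z t ω) : ℝ) : ℂ)) ∂P := by
        simp only [mul_comm Complex.I, real_inner_comm]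
    _ = _ := h1.trans h2.symm
    _ = _ := by
        refine integral_congr_ae (Filter.Eventually.of_forall fun y => ?_)
        simp only
        rw [ENNReal.toReal_ofReal (hρ0 y), Complex.real_smul, hρ y, mul_comm]
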